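/- Let $M$ be a matroid of rank $4$ with rank function $r$ on a finite or countably infinite ground set $E(M)$. Call a pair $(X,Y)$ of sets a modular pair if $r(X)+r(Y)=r(X\cup Y)+r(X\cap Y)$. A matroid is modular if all pairs of flats are modular pairs, and hypermodular if all pairs of hyperplanes are modular pairs. A modular cut of a matroid is a set $\mathcal C$ of flats such that every flat containing a member of $\mathcal C$ belongs to $\mathcal C$, and $F\cap G\in\mathcal C$ whenever $F,G\in\mathcal C$ form a modular pair; it is principal if it consists of all flats containing some fixed flat. A matroid is OTE (only trivially extendable) if each of its nonempty modular cuts is principal. Lines and planes are flats of rank $2$ and $3$; sets are coplanar if a plane contains all of them; two lines are called disjoint if they have no non-loop element in common. A matroid of rank at least $4$ satisfies the bundle condition if for any four pairwise disjoint lines $l_1,l_2,l_3,l_4$, no three of them coplanar, the following holds: if five of the six pairs $l_i,l_j$ are coplanar, then all six pairs are coplanar. Suppose that $M$ is hypermodular. Then, up to renaming the elements of $M$, there is a matroid $\overline M$ of rank $4$ with $E(M)\subseteq E(\overline M)$ and $\overline M|E(M)=M$ such that $\overline M$ is OTE and, for every line $L$ of $\overline M$, the set $L\cap E(M)$ is a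 line of $M$. Furthermore: 1. $\overline M$ is finite if and only if $M$ is finite. 2. For every $p\in E(M)$ that is not a loop, the simplification of $\overline M/p$ is isomorphic to the simplification of $M/p$. 3. If $M$ satisfies the bundle condition, then $\overline M$ is modular. -/

import Mathlib

universe u v

noncomputable section

namespace Matroid

variable {α : Type u} {β : Type v}

/-- A line: a flat of rank two. -/
def IsLine (M : Matroid α) (L : Set α) : Prop := M.IsFlat L ∧ M.eRk L = 2

/-- A plane: a flat of rank three. -/
def IsPlane (M : Matroid α) (P : Set α) : Prop := M.IsFlat P ∧ M.eRk P = 3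

/-- A hyperplane of a matroid of finite rank `r`: a flat of rank `r - 1`. -/
def IsHyperplane (M : Matroid α) (H : Set α) : Prop := M.IsFlat H ∧ M.eRk H + 1 = M.eRank

/-- `X` is contained in some plane of `M`. -/
def Coplanar (M : Matroid α) (X : Set α) : Prop := ∃ P, M.IsPlane P ∧ X ⊆ P

/-- `(X, Y)` is a modular pair (of a matroid of finite rank): the modular defect
`r(X) + r(Y) - r(X ∪ Y) - r(X ∩ Y)` is zero. -/
def IsModularPair (M : Matroid α) (X Y : Set α) : Prop :=
  M.eRk X + M.eRk Y = M.eRk (X ∪ Y) + M.eRk (X ∩ Y)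

/-- All pairs of flats are modular pairs. -/
def IsModular (M : Matroid α) : Prop :=
  ∀ X Y, M.IsFlat X → M.IsFlat Y → M.IsModularPair X Y

/-- All pairs of hyperplanes are modular pairs. -/
def IsHypermodular (M : Matroid α) : Prop :=
  ∀ X Y, M.IsHyperplane X → M.IsHyperplane Y → M.IsModularPair X Y

/-- Modular cuts: sets of flats closed under larger flats and under intersections of
modular pairs. -/
structure IsModularCut (M : Matroid α) (C : Set (Set α)) : Prop where
  isFlat : ∀ F ∈ C, M.IsFlat F
  superset : ∀ F ∈ C, ∀ G, M.IsFlat G → F ⊆ G → G ∈ C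
  inter : ∀ F ∈ C, ∀ G ∈ C, M.IsModularPair F G → F ∩ G ∈ C

/-- The principal modular cut of a flat `F`: all flats containing `F`. -/
def principalModularCut (M : Matroid α) (F : Set α) : Set (Set α) := {G | M.IsFlat G ∧ F ⊆ G}

/-- OTE ("only trivially extendable"): every nonempty modular cut is principal. -/
def IsOTE (M : Matroid α) : Prop :=
  ∀ C, M.IsModularCut C → C.Nonempty → ∃ F, M.IsFlat F ∧ C = M.principalModularCut F

/-- Two sets are disjoint up to loops. All flats contain all loops, so this is disjointness of
flats in the lattice of flats; it is plain disjointness if there are no loops. -/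
def PointDisjoint (M : Matroid α) (X Y : Set α) : Prop := X ∩ Y ⊆ M.loops

/-- The bundle condition: for any four pairwise disjoint lines, no three of them coplanar,
if five of the six pairs of these lines are coplanar, then all six pairs are. -/
def BundleCondition (M : Matroid α) : Prop :=
  ∀ l : Fin 4 → Set α,
    (∀ i, M.IsLine (l i)) →
    (∀ i j, i < j → M.PointDisjoint (l i) (l j)) →
    (∀ i j k, i < j → j < k → ¬ M.Coplanar (l i ∪ l j ∪ l k)) →
    (∃ i j, i < j ∧ ∀ k m, k < m → (k, m) ≠ (i, j) → M.Coplanar (l k ∪ l m)) →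
    ∀ k m, k < m → M.Coplanar (l k ∪ l m)

/-- The points (parallel classes together with the loops, i.e. rank-one flats) of `M`,
each being the closure of a nonloop. -/
def Point (M : Matroid α) : Type u := {P : Set α // ∃ e, M.IsNonloop e ∧ M.closure {e} = P}

/-- A nonloop representing a point. -/
def Point.rep {M : Matroid α} (P : M.Point) : α := P.2.choose

/-- The simplification of `M`, with the points of `M` as elements: a set of points is independent
if and only if the set of their representatives (one nonloop from each parallel class) is. -/
def simplification (M : Matroid α) : Matroid M.Point := M.comap Point.rep

/-- Isomorphism of matroids: a bijection of the ground sets that preserves independence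
in both directions. -/
def Isomorphic (M : Matroid α) (N : Matroid β) : Prop :=
  ∃ e : M.E ≃ N.E, ∀ I : Set M.E,
    M.Indep (Subtype.val '' I) ↔ N.Indep (Subtype.val '' (e '' I))

end Matroid

end

/-! A spread is a partition of the points of `M` into pairwise coplanar lines. In a hypermodular
matroid of rank 4 the lines of a nonprincipal modular cut form a spread (`IsModularCut.isSpread`),
and conversely a spread generates a nonprincipal modular cut (`IsOTE.not_isSpread`), so being OTE
means having no spread. Since two planes meet in a line, a spread is determined by two of its lines
(`IsSpread.eq_of_two`).

Take a maximal set `𝒞` of spreads any two of which share a line, and make each member a new point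
lying on exactly its own lines. The flats of the extension are the new points and the flats of `M`,
each enlarged by the spreads with a line in it. Lines and planes are thus those of `M` up to new
points, and hypermodularity survives. A spread of the extension would restrict to a spread of `M`
sharing a line with every member of `𝒞`, hence itself in `𝒞` by maximality; as a point it would lie
on all lines of the given spread, which are disjoint. So the extension is OTE
(`IsCompatible.isOTE_extension`).

The bundle condition passes to the extension, where it completes any two disjoint coplanar lines to
a spread (`BundleCondition.exists_isSpread`). OTE forbids this, and without disjoint coplanar lines
the matroid is modular. -/

namespace Matroid

open Set

/-! ### Ranks as natural numbers, and flats in finite rank. -/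

section Rank

variable {α : Type*} {M : Matroid α} {X Y F G : Set α} {p q : α}

/-- The rank of a set as a natural number (meaningful in matroids of finite rank). -/
noncomputable def natRk (M : Matroid α) (X : Set α) : ℕ := (M.eRk X).toNat

lemma coe_natRk (M : Matroid α) [M.RankFinite] (X : Set α) : (M.natRk X : ℕ∞) = M.eRk X :=
  ENat.natCast_toNat (eRk_ne_top_iff.2 (RankFinite.isRkFinite X))

lemma eRk_eq_coe_iff [M.RankFinite] {n : ℕ} : M.eRk X = n ↔ M.natRk X = n := by
  rw [← coe_natRk, Nat.cast_inj]

lemma natRk_closure_eq (M : Matroid α) (X : Set α) : M.natRk (M.closure X) = M.natRk X := by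
  rw [natRk, natRk, eRk_closure_eq]

lemma natRk_mono (M : Matroid α) [M.RankFinite] (h : X ⊆ Y) : M.natRk X ≤ M.natRk Y := by
  have := M.eRk_mono h
  rwa [← coe_natRk, ← coe_natRk, Nat.cast_le] at this

lemma natRk_inter_add_natRk_union_le (M : Matroid α) [M.RankFinite] (X Y : Set α) :
    M.natRk (X ∩ Y) + M.natRk (X ∪ Y) ≤ M.natRk X + M.natRk Y := by
  have := M.eRk_inter_add_eRk_union_le X Y
  simp only [← coe_natRk] at this
  exact_mod_cast this

lemma isModularPair_iff [M.RankFinite] : M.IsModularPair X Y ↔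
    M.natRk X + M.natRk Y = M.natRk (X ∪ Y) + M.natRk (X ∩ Y) := by
  simp only [IsModularPair, ← coe_natRk]
  norm_cast

lemma natRk_insert_le (M : Matroid α) [M.RankFinite] (q : α) (X : Set α) :
    M.natRk (insert q X) ≤ M.natRk X + 1 := by
  have := M.eRk_insert_le_add_one q X
  simp only [← coe_natRk] at this
  exact_mod_cast this

lemma natRk_insert_eq [M.RankFinite] (hq : q ∈ M.E) (h : q ∉ M.closure X) :
    M.natRk (insert q X) = M.natRk X + 1 := by
  have := M.eRk_insert_eq_add_one ⟨hq, h⟩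
  simp only [← coe_natRk] at this
  exact_mod_cast this

lemma natRk_loops (M : Matroid α) : M.natRk M.loops = 0 := by
  simp [natRk]

lemma natRk_eq_zero_of_subset_loops [M.RankFinite] (h : X ⊆ M.loops) : M.natRk X = 0 := by
  have := M.natRk_mono h
  rw [natRk_loops] at this
  omega

lemma natRk_singleton (hq : M.IsNonloop q) : M.natRk {q} = 1 := by
  simp [natRk, hq.eRk_eq]

lemma natRk_pos_of_mem [M.RankFinite] (hq : M.IsNonloop q) (h : q ∈ X) : 1 ≤ M.natRk X := by
  rw [← natRk_singleton hq]
  exact M.natRk_mono (singleton_subset_iff.2 h)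

lemma exists_isNonloop_mem (hX : X ⊆ M.E) (h : 1 ≤ M.natRk X) :
    ∃ q ∈ X, M.IsNonloop q := by
  by_contra! hcon
  have : M.eRk X = 0 := by
    rw [eRk_eq_zero_iff hX]
    intro x hx
    exact isLoop_of_not_isNonloop (hX hx) (hcon x hx)
  simp [natRk, this] at h

lemma IsFlat.inter (hF : M.IsFlat F) (hG : M.IsFlat G) : M.IsFlat (F ∩ G) := by
  rw [inter_eq_iInter]
  exact IsFlat.iInter (by rintro (_ | _) <;> assumption)

lemma IsFlat.closure_subset (hF : M.IsFlat F) (h : X ⊆ F) : M.closure X ⊆ F := by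
  rw [← hF.closure]
  exact M.closure_subset_closure h

/-- Nested sets of equal finite rank have the same closure. This is how rank counts become
inclusions below. -/
lemma IsFlat.subset_of_natRk_le [M.RankFinite] (hF : M.IsFlat F) (hX : X ⊆ F) (hXY : X ⊆ Y)
    (hY : Y ⊆ M.E) (h : M.natRk Y ≤ M.natRk X) : Y ⊆ F := by
  have := (RankFinite.isRkFinite (M := M) X).closure_eq_closure_of_subset_of_eRk_ge_eRk hXY
    (by rw [← coe_natRk, ← coe_natRk]; exact_mod_cast h)
  exact (M.subset_closure Y).trans (this ▸ hF.closure_subset hX)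

lemma IsFlat.eq_of_subset_of_natRk_le [M.RankFinite] (hF : M.IsFlat F) (hG : M.IsFlat G)
    (h : F ⊆ G) (hr : M.natRk G ≤ M.natRk F) : F = G :=
  h.antisymm (hF.subset_of_natRk_le Subset.rfl h hG.subset_ground hr)

lemma IsFlat.natRk_lt_of_ssubset [M.RankFinite] (hF : M.IsFlat F) (hG : M.IsFlat G)
    (h : F ⊂ G) : M.natRk F < M.natRk G := by
  by_contra! hle
  exact h.ne (hF.eq_of_subset_of_natRk_le hG h.subset hle)

lemma IsFlat.natRk_insert [M.RankFinite] (hF : M.IsFlat F) (hq : q ∈ M.E) (h : q ∉ F) :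
    M.natRk (insert q F) = M.natRk F + 1 :=
  natRk_insert_eq hq (by rwa [hF.closure])

lemma IsFlat.natRk_lt_natRk_union [M.RankFinite] (hF : M.IsFlat F) (h : ¬ X ⊆ F)
    (hX : X ⊆ M.E) : M.natRk F < M.natRk (X ∪ F) := by
  obtain ⟨q, hqX, hqF⟩ := not_subset.1 h
  have h1 := hF.natRk_insert (hX hqX) hqF
  have h2 := M.natRk_mono (show insert q F ⊆ X ∪ F from
    insert_subset (Or.inl hqX) subset_union_right)
  omega

lemma IsFlat.natRk_inter_lt [M.RankFinite] (hF : M.IsFlat F) (hG : M.IsFlat G) (h : ¬ F ⊆ G) :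
    M.natRk (F ∩ G) < M.natRk F :=
  (hF.inter hG).natRk_lt_of_ssubset hF
    (inter_subset_left.ssubset_of_ne fun h' ↦ h (inter_eq_left.1 h'))

lemma isLine_iff [M.RankFinite] : M.IsLine F ↔ M.IsFlat F ∧ M.natRk F = 2 := by
  rw [IsLine, ← eRk_eq_coe_iff]; rfl

lemma IsLine.subset_closure_insert (hF : M.IsLine F) (hq : q ∈ M.E) :
    insert q F ⊆ M.closure (insert q F) :=
  M.subset_closure _ (insert_subset hq hF.1.subset_ground)

lemma isPlane_iff [M.RankFinite] : M.IsPlane F ↔ M.IsFlat F ∧ M.natRk F = 3 := by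
  rw [IsPlane, ← eRk_eq_coe_iff]; rfl

lemma isFlat_loops (M : Matroid α) : M.IsFlat M.loops := M.isFlat_closure ∅

lemma IsFlat.eq_loops_of_natRk [M.RankFinite] (hF : M.IsFlat F) (h : M.natRk F = 0) :
    F = M.loops :=
  ((isFlat_loops M).eq_of_subset_of_natRk_le hF hF.loops_subset (by omega)).symm

lemma IsFlat.isNonloop_of_notMem (hF : M.IsFlat F) (hq : q ∈ M.E) (h : q ∉ F) :
    M.IsNonloop q :=
  (isNonloop_iff_notMem_loops hq).2 fun hl ↦ h (hF.loops_subset hl)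

end Rank

/-! ### Hypermodular matroids of rank four. -/

/-- Hypermodular matroids of rank four. -/
class HypermodularRankFour {α : Type*} (M : Matroid α) : Prop where
  rankFinite : M.RankFinite
  natRk_ground : M.natRk M.E = 4
  two_le_natRk_inter : ∀ P Q, M.IsPlane P → M.IsPlane Q → 2 ≤ M.natRk (P ∩ Q)

section Hypermodular

variable {α : Type*} {M : Matroid α} {F G L K P Q : Set α} {q : α}

instance [h : M.HypermodularRankFour] : M.RankFinite := h.rankFinite

lemma hypermodularRankFour_of_isHypermodular (hr : M.eRank = 4) (h : M.IsHypermodular) :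
    M.HypermodularRankFour := by
  have hfin : M.RankFinite := by rw [← eRank_ne_top_iff, hr]; simp
  have hE : M.natRk M.E = 4 := by
    rw [← eRk_eq_coe_iff, eRk_ground, hr]; rfl
  refine ⟨hfin, hE, fun P Q hP hQ ↦ ?_⟩
  have hyp : ∀ {P}, M.IsPlane P → M.IsHyperplane P := fun hP ↦ ⟨hP.1, by rw [hP.2, hr]; rfl⟩
  have := isModularPair_iff.1 (h P Q (hyp hP) (hyp hQ))
  have h4 := M.natRk_mono (union_subset hP.1.subset_ground hQ.1.subset_ground)
  have := (isPlane_iff.1 hP).2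
  have := (isPlane_iff.1 hQ).2
  omega

variable [M.HypermodularRankFour]

lemma natRk_le_four (X : Set α) : M.natRk X ≤ 4 := by
  rw [← HypermodularRankFour.natRk_ground (M := M), natRk, natRk, eRk_ground]
  exact ENat.toNat_le_toNat (M.eRk_le_eRank X) ((eRank_ne_top_iff M).2 inferInstance)

lemma IsFlat.eq_ground_of_natRk (hF : M.IsFlat F) (h : 4 ≤ M.natRk F) : F = M.E :=
  hF.eq_of_subset_of_natRk_le M.ground_isFlat hF.subset_ground (by
    rw [HypermodularRankFour.natRk_ground]; exact h)

lemma two_le_natRk_inter (hF : M.IsFlat F) (hG : M.IsFlat G) (hF3 : 3 ≤ M.natRk F)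
    (hG3 : 3 ≤ M.natRk G) : 2 ≤ M.natRk (F ∩ G) := by
  obtain hF4 | hF4 := Nat.lt_or_ge (M.natRk F) 4
  · obtain hG4 | hG4 := Nat.lt_or_ge (M.natRk G) 4
    · exact HypermodularRankFour.two_le_natRk_inter F G (isPlane_iff.2 ⟨hF, by omega⟩)
        (isPlane_iff.2 ⟨hG, by omega⟩)
    · rw [hG.eq_ground_of_natRk hG4, inter_eq_self_of_subset_left hF.subset_ground]
      omega
  · rw [hF.eq_ground_of_natRk hF4, inter_eq_self_of_subset_right hG.subset_ground]
    omega

lemma IsFlat.inter_eq_of_isLine (hP : M.IsFlat P) (hP3 : M.natRk P ≤ 3) (hQ : M.IsFlat Q)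
    (hPQ : ¬ P ⊆ Q) (hL : M.IsLine L) (hLP : L ⊆ P) (hLQ : L ⊆ Q) :
    P ∩ Q = L := by
  rw [isLine_iff] at hL
  refine (hL.1.eq_of_subset_of_natRk_le (hP.inter hQ) (subset_inter hLP hLQ) ?_).symm
  have := hP.natRk_inter_lt hQ hPQ
  omega

/-- A set of rank below 3 is enlarged by elements outside its closure until it spans a plane; rank 4
supplies such elements. -/
lemma coplanar_iff {X : Set α} (hX : X ⊆ M.E) : M.Coplanar X ↔ M.natRk X ≤ 3 := by
  constructor
  · rintro ⟨P, hP, hXP⟩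
    have := M.natRk_mono hXP
    rw [isPlane_iff] at hP
    omega
  intro h
  obtain ⟨n, hn⟩ : ∃ n, M.natRk X + n = 3 := ⟨3 - M.natRk X, by omega⟩
  induction n generalizing X with
  | zero =>
    exact ⟨M.closure X, isPlane_iff.2 ⟨M.isFlat_closure X, by rw [natRk_closure_eq]; omega⟩,
      M.subset_closure X⟩
  | succ n ih =>
    obtain ⟨e, heE, he⟩ : ∃ e ∈ M.E, e ∉ M.closure X := by
      by_contra! hcon
      have := M.natRk_mono (show M.E ⊆ M.closure X from hcon)
      rw [natRk_closure_eq, HypermodularRankFour.natRk_ground] at this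
      omega
    have hr := natRk_insert_eq heE he
    obtain ⟨P, hP, hXP⟩ := ih (insert_subset heE hX) (by omega) (by omega)
    exact ⟨P, hP, (subset_insert e X).trans hXP⟩

lemma exists_notMem_of_natRk_le {X : Set α} (h : M.natRk X ≤ 3) :
    ∃ e, M.IsNonloop e ∧ e ∉ M.closure X := by
  by_contra! hcon
  have hE : M.E ⊆ M.closure X := by
    intro e he
    by_contra hne
    exact hne (hcon e ((M.isFlat_closure X).isNonloop_of_notMem he hne))
  have := M.natRk_mono hE
  rw [natRk_closure_eq, HypermodularRankFour.natRk_ground] at this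
  omega

end Hypermodular

/-! ### Spreads and their determination by two lines. -/

/-- A partition of the points of `M` into pairwise coplanar lines. -/
structure IsSpread {α : Type*} (M : Matroid α) (S : Set (Set α)) : Prop where
  isLine : ∀ L ∈ S, M.IsLine L
  exists_mem : ∀ q, M.IsNonloop q → ∃ L ∈ S, q ∈ L
  eq_of_mem : ∀ L ∈ S, ∀ K ∈ S, ∀ q, M.IsNonloop q → q ∈ L → q ∈ K → L = K
  natRk_union_le : ∀ L ∈ S, ∀ K ∈ S, M.natRk (L ∪ K) ≤ 3

section Spread

variable {α : Type*} {M : Matroid α} {S T : Set (Set α)} {F G J L K : Set α} {q : α}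
  [M.HypermodularRankFour]

lemma IsLine.exists_mem (hL : M.IsLine L) : ∃ q ∈ L, M.IsNonloop q :=
  exists_isNonloop_mem hL.1.subset_ground (by rw [isLine_iff] at hL; omega)

/-- A flat containing the line `L` and a further point of the plane spanned by two coplanar lines
`L` and `K` contains `K`. -/
lemma IsLine.subset_of_mem_closure (hL : M.IsLine L) (hKE : K ⊆ M.E) (hLK : M.natRk (L ∪ K) ≤ 3)
    (hF : M.IsFlat F) (hLF : L ⊆ F) (hqL : q ∉ L) (hqF : q ∈ F) (hq : q ∈ M.closure (L ∪ K)) :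
    K ⊆ F := by
  have hL' := isLine_iff.1 hL
  have hE := union_subset hL'.1.subset_ground hKE
  have hr := hL'.1.natRk_insert (hF.subset_ground hqF) hqL
  have hs := M.subset_closure (L ∪ K) hE
  exact (subset_union_right.trans hs).trans (hF.subset_of_natRk_le (insert_subset hqF hLF)
    (insert_subset hq (subset_union_left.trans hs)) (M.closure_subset_ground _)
    (by rw [natRk_closure_eq]; omega))

/-- The line through `q` of a spread lies in every flat that contains `q` and some line of the
spread. -/
lemma IsSpread.subset_of_mem (hS : M.IsSpread S) (hF : M.IsFlat F) (hL : L ∈ S) (hLF : L ⊆ F)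
    (hq : M.IsNonloop q) (hqF : q ∈ F) (hK : K ∈ S) (hqK : q ∈ K) : K ⊆ F := by
  by_cases hqL : q ∈ L
  · rwa [hS.eq_of_mem K hK L hL q hq hqK hqL]
  have hKE := (hS.isLine K hK).1.subset_ground
  exact (hS.isLine L hL).subset_of_mem_closure hKE (hS.natRk_union_le L hL K hK) hF hLF hqL hqF
    (M.mem_closure_of_mem' (Or.inr hqK) (hKE hqK))

lemma IsLine.eq_of_subset (hL : M.IsLine L) (hK : M.IsLine K) (h : L ⊆ K) : L = K := by
  rw [isLine_iff] at hL hK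
  exact hL.1.eq_of_subset_of_natRk_le hK.1 h (by omega)

lemma IsLine.eq_of_natRk_union_le (hL : M.IsLine L) (hK : M.IsLine K)
    (h : M.natRk (L ∪ K) ≤ 2) : L = K := by
  refine (hK.eq_of_subset hL ?_).symm
  have hKE := hK.1.subset_ground
  rw [isLine_iff] at hL
  exact subset_union_right.trans (hL.1.subset_of_natRk_le Subset.rfl subset_union_left
    (union_subset hL.1.subset_ground hKE) (by omega))

lemma IsLine.natRk_insert (hL : M.IsLine L) (hq : q ∈ M.E) (h : q ∉ L) :
    M.natRk (insert q L) = 3 := by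
  rw [isLine_iff] at hL
  rw [hL.1.natRk_insert hq h, hL.2]

lemma IsLine.natRk_closure_insert (hL : M.IsLine L) (hq : q ∈ M.E) (h : q ∉ L) :
    M.natRk (M.closure (insert q L)) = 3 := by
  rw [natRk_closure_eq, hL.natRk_insert hq h]

lemma isLine_inter (hF : M.IsFlat F) (hG : M.IsFlat G) (hF3 : M.natRk F = 3)
    (hG3 : M.natRk G = 3) (h : ¬ F ⊆ G) : M.IsLine (F ∩ G) := by
  have h1 := two_le_natRk_inter hF hG hF3.ge hG3.ge
  have h2 := hF.natRk_inter_lt hG h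
  exact isLine_iff.2 ⟨hF.inter hG, by omega⟩

/-- Otherwise the plane spanned by `q` and `K` would contain `L ∪ K`, of rank at least 3, together
with `q` outside its closure. -/
lemma not_closure_insert_subset (hL : M.IsLine L) (hK : M.IsLine K) (hne : L ≠ K)
    (hq : q ∈ M.E) (hqLK : q ∉ M.closure (L ∪ K)) :
    ¬ M.closure (insert q L) ⊆ M.closure (insert q K) := by
  intro hsub
  have hLE := hL.1.subset_ground
  have hKE := hK.1.subset_ground
  have hs := M.subset_closure (L ∪ K) (union_subset hLE hKE)
  have h2 := hK.natRk_closure_insert hq (fun h ↦ hqLK (hs (Or.inr h)))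
  have hi := hK.subset_closure_insert hq
  have hsub' : L ∪ K ⊆ M.closure (insert q K) :=
    union_subset (((subset_insert q L).trans (hL.subset_closure_insert hq)).trans hsub)
      ((subset_insert q K).trans hi)
  have h6 : 3 ≤ M.natRk (L ∪ K) := by
    by_contra! hlt
    exact hne (hL.eq_of_natRk_union_le hK (by omega))
  have h7 := natRk_insert_eq hq hqLK
  have h8 := M.natRk_mono (insert_subset (hi (mem_insert q K)) hsub')
  omega

/-- If `q` is outside of the plane spanned by two coplanar lines, then the planes spanned by `q`
and these lines meet in a line. -/
lemma isLine_inter_of_notMem (hL : M.IsLine L) (hK : M.IsLine K) (hne : L ≠ K)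
    (hq : q ∈ M.E) (hqLK : q ∉ M.closure (L ∪ K)) :
    M.IsLine (M.closure (insert q L) ∩ M.closure (insert q K)) := by
  have hs := M.subset_closure (L ∪ K) (union_subset hL.1.subset_ground hK.1.subset_ground)
  exact isLine_inter (M.isFlat_closure _) (M.isFlat_closure _)
    (hL.natRk_closure_insert hq (fun h ↦ hqLK (hs (Or.inl h))))
    (hK.natRk_closure_insert hq (fun h ↦ hqLK (hs (Or.inr h))))
    (not_closure_insert_subset hL hK hne hq hqLK)

/-- The plane through `q` and any line of the spread contains the line of the spread through `q`.
Two such planes leave only one choice for it. -/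
lemma IsSpread.eq_inter (hS : M.IsSpread S) (hL : L ∈ S) (hK : K ∈ S) (hne : L ≠ K)
    (hJ : J ∈ S) (hq : M.IsNonloop q) (hqJ : q ∈ J) (hqLK : q ∉ M.closure (L ∪ K)) :
    J = M.closure (insert q L) ∩ M.closure (insert q K) := by
  refine (hS.isLine J hJ).eq_of_subset
    (isLine_inter_of_notMem (hS.isLine L hL) (hS.isLine K hK) hne hq.mem_ground hqLK) ?_
  have key : ∀ L ∈ S, J ⊆ M.closure (insert q L) := fun L hL ↦ by
    have := (hS.isLine L hL).subset_closure_insert hq.mem_ground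
    exact hS.subset_of_mem (M.isFlat_closure _) hL ((subset_insert q L).trans this) hq
      (this (mem_insert _ _)) hJ hqJ
  exact subset_inter (key L hL) (key K hK)

/-- By `IsSpread.eq_inter`, the lines through points off the plane of `L` and `K` are forced; the
points of that plane need a different second line. -/
lemma IsSpread.subset_of_two (hS : M.IsSpread S) (hT : M.IsSpread T) (hL : L ∈ S) (hK : K ∈ S)
    (hne : L ≠ K) (hLT : L ∈ T) (hKT : K ∈ T) : S ⊆ T := by
  have key : ∀ L ∈ S ∩ T, ∀ K ∈ S ∩ T, L ≠ K → ∀ J ∈ S, ∀ q ∈ J, M.IsNonloop q →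
      q ∉ M.closure (L ∪ K) → J ∈ T := by
    intro L hL K hK hne J hJ q hqJ hq hqLK
    obtain ⟨J', hJ', hqJ'⟩ := hT.exists_mem q hq
    rwa [hS.eq_inter hL.1 hK.1 hne hJ hq hqJ hqLK,
      ← hT.eq_inter hL.2 hK.2 hne hJ' hq hqJ' hqLK]
  intro J hJ
  obtain ⟨q, hqJ, hq⟩ := (hS.isLine J hJ).exists_mem
  by_cases hqLK : q ∈ M.closure (L ∪ K)
  · by_cases hqL : q ∈ L
    · rwa [hS.eq_of_mem J hJ L hL q hq hqJ hqL]
    -- Exchange `K` for a line `H` through a point off the plane of `L` and `K`. If `q` also lay in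
    -- the plane of `L` and `H`, the two planes would share `L` and `q` and hence coincide.
    obtain ⟨p, hp, hpLK⟩ := exists_notMem_of_natRk_le (hS.natRk_union_le L hL K hK)
    obtain ⟨H, hH, hpH⟩ := hS.exists_mem p hp
    have hHT := key L ⟨hL, hLT⟩ K ⟨hK, hKT⟩ hne H hH p hpH hp hpLK
    have hs := M.subset_closure (L ∪ K)
      (union_subset (hS.isLine L hL).1.subset_ground (hS.isLine K hK).1.subset_ground)
    refine key L ⟨hL, hLT⟩ H ⟨hH, hHT⟩ ?_ J hJ q hqJ hq fun hqLH ↦ hpLK ?_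
    · rintro rfl
      exact hpLK (hs (Or.inl hpH))
    · exact (hS.isLine L hL).subset_of_mem_closure (hS.isLine H hH).1.subset_ground
        (hS.natRk_union_le L hL H hH) (M.isFlat_closure _) (subset_union_left.trans hs)
        hqL hqLK hqLH hpH
  · exact key L ⟨hL, hLT⟩ K ⟨hK, hKT⟩ hne J hJ q hqJ hq hqLK

lemma IsSpread.eq_of_two (hS : M.IsSpread S) (hT : M.IsSpread T) (hL : L ∈ S) (hK : K ∈ S)
    (hne : L ≠ K) (hLT : L ∈ T) (hKT : K ∈ T) : S = T :=
  (hS.subset_of_two hT hL hK hne hLT hKT).antisymm (hT.subset_of_two hS hLT hKT hne hL hK)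

lemma IsSpread.exists_subset_ground (hS : M.IsSpread S) : ∃ L ∈ S, L ⊆ M.E := by
  obtain ⟨q, hq, -⟩ := exists_notMem_of_natRk_le (M := M) (X := ∅) (by simp [natRk])
  obtain ⟨L, hL, -⟩ := hS.exists_mem q hq
  exact ⟨L, hL, (hS.isLine L hL).1.subset_ground⟩

end Spread

/-! ### Nonprincipal modular cuts correspond to spreads. -/

section ModularCut

variable {α : Type*} {M : Matroid α} {C S : Set (Set α)} {F G : Set α}

lemma IsModularCut.eq_principal (hC : M.IsModularCut C) (hF : F ∈ C) (h : ∀ G ∈ C, F ⊆ G) :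
    C = M.principalModularCut F :=
  ext fun G ↦ ⟨fun hG ↦ ⟨hC.isFlat G hG, h G hG⟩, fun hG ↦ hC.superset F hF G hG.1 hG.2⟩

variable [M.HypermodularRankFour]

/-- A cut containing the flat of loops is principal. A point in the cut forms a modular pair with
any member avoiding it, and their intersection would be the flat of loops. -/
lemma IsModularCut.two_le_natRk (hC : M.IsModularCut C)
    (hnp : ¬ ∃ F, M.IsFlat F ∧ C = M.principalModularCut F) (hF : F ∈ C) : 2 ≤ M.natRk F := by
  have h0 : M.loops ∉ C := fun h ↦
    hnp ⟨_, isFlat_loops M, hC.eq_principal h fun G hG ↦ (hC.isFlat G hG).loops_subset⟩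
  have hFf := hC.isFlat F hF
  by_contra! hlt
  obtain h | h : M.natRk F = 0 ∨ M.natRk F = 1 := by omega
  · exact h0 (hFf.eq_loops_of_natRk h ▸ hF)
  refine hnp ⟨F, hFf, hC.eq_principal hF fun G hG ↦ ?_⟩
  by_contra hFG
  have hGf := hC.isFlat G hG
  have h1 := hFf.natRk_inter_lt hGf hFG
  have h2 := hGf.natRk_lt_natRk_union hFG hFf.subset_ground
  have h4 := M.natRk_inter_add_natRk_union_le F G
  refine h0 ?_
  rw [← (hFf.inter hGf).eq_loops_of_natRk (by omega)]
  exact hC.inter F hF G hG (isModularPair_iff.2 (by omega))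

/-- Distinct planes form a modular pair, since 3 + 3 = 4 + 2. -/
lemma IsModularCut.inter_mem (hC : M.IsModularCut C) (hF : F ∈ C) (hG : G ∈ C)
    (hF3 : M.natRk F = 3) (hG3 : M.natRk G = 3) (h : ¬ F ⊆ G) :
    M.IsLine (F ∩ G) ∧ F ∩ G ∈ C := by
  have hFf := hC.isFlat F hF
  have hGf := hC.isFlat G hG
  have hl := isLine_inter hFf hGf hF3 hG3 h
  refine ⟨hl, hC.inter F hF G hG (isModularPair_iff.2 ?_)⟩
  have h1 := M.natRk_inter_add_natRk_union_le F G
  have h2 := hGf.natRk_lt_natRk_union h hFf.subset_ground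
  have h4 := natRk_le_four (M := M) (F ∪ G)
  rw [isLine_iff] at hl
  omega

/-- A nonprincipal cut has no least member, so every member `F` fails to lie in some other member.
Lines are then produced by intersecting planes of the cut. -/
lemma IsModularCut.exists_two_lines (hC : M.IsModularCut C) (hne : C.Nonempty)
    (hnp : ¬ ∃ F, M.IsFlat F ∧ C = M.principalModularCut F) :
    ∃ L ∈ C, ∃ K ∈ C, M.IsLine L ∧ M.IsLine K ∧ L ≠ K := by
  have htwo : ∀ {F}, F ∈ C → 2 ≤ M.natRk F := fun hF ↦ hC.two_le_natRk hnp hF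
  have hE : M.E ∈ C := by
    obtain ⟨F, hF⟩ := hne
    exact hC.superset F hF _ M.ground_isFlat (hC.isFlat F hF).subset_ground
  have hother : ∀ F ∈ C, ∃ G ∈ C, ¬ F ⊆ G := by
    intro F hF
    by_contra! hcon
    exact hnp ⟨F, hC.isFlat F hF, hC.eq_principal hF hcon⟩
  have hrank : ∀ {F}, F ∈ C → F ≠ M.E → ¬ M.IsLine F → M.natRk F = 3 := by
    intro F hF hFE hFl
    have h1 := htwo hF
    have h2 : M.natRk F ≠ 2 := fun h ↦ hFl (isLine_iff.2 ⟨hC.isFlat F hF, h⟩)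
    have h3 : ¬ 4 ≤ M.natRk F := fun h ↦ hFE ((hC.isFlat F hF).eq_ground_of_natRk h)
    omega
  have hneE : ∀ {F G}, F ∈ C → ¬ F ⊆ G → G ≠ M.E := by
    rintro F G hF hFG rfl
    exact hFG (hC.isFlat F hF).subset_ground
  obtain ⟨L, hL, hLl⟩ : ∃ L ∈ C, M.IsLine L := by
    by_contra! hcon
    obtain ⟨P, hP, hPE⟩ := hother _ hE
    obtain ⟨Q, hQ, hPQ⟩ := hother _ hP
    have := hC.inter_mem hP hQ (hrank hP (hneE hE hPE) (hcon P hP))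
      (hrank hQ (hneE hP hPQ) (hcon Q hQ)) hPQ
    exact hcon _ this.2 this.1
  obtain ⟨G, hG, hLG⟩ := hother L hL
  by_cases hGl : M.IsLine G
  · exact ⟨L, hL, G, hG, hLl, hGl, fun h ↦ hLG h.subset⟩
  -- Here `G` is a plane not containing `L`. Any plane through `L` cuts it in a line of the cut,
  -- which differs from `L` because it lies in `G`.
  obtain ⟨q, hq, hqL⟩ := exists_notMem_of_natRk_le (M := M) (X := L)
    (by rw [isLine_iff] at hLl; omega)
  rw [hLl.1.closure] at hqL
  have hi := hLl.subset_closure_insert hq.mem_ground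
  have hLi := (subset_insert q L).trans hi
  have := hC.inter_mem (hC.superset L hL _ (M.isFlat_closure _) hLi) hG
    (hLl.natRk_closure_insert hq.mem_ground hqL) (hrank hG (hneE hL hLG) hGl)
    (fun h ↦ hLG (hLi.trans h))
  exact ⟨L, hL, _, this.2, hLl, this.1, fun h ↦ hLG (h.subset.trans inter_subset_right)⟩

/-- The lines of a nonprincipal modular cut form a spread. -/
lemma IsModularCut.isSpread (hC : M.IsModularCut C) (hne : C.Nonempty)
    (hnp : ¬ ∃ F, M.IsFlat F ∧ C = M.principalModularCut F) :
    M.IsSpread {L | L ∈ C ∧ M.IsLine L} := by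
  -- Distinct lines meet in rank at most 1, too small for a member of the cut, so they are not a
  -- modular pair. Submodularity is then strict, which leaves only rank 3 for the union and 0 for
  -- the intersection.
  have hpair : ∀ L ∈ C, ∀ K ∈ C, M.IsLine L → M.IsLine K → L ≠ K →
      M.natRk (L ∩ K) = 0 ∧ M.natRk (L ∪ K) ≤ 3 := by
    intro L hL K hK hLl hKl hLK
    have h1 := M.natRk_inter_add_natRk_union_le L K
    have h2 : ¬ M.natRk (L ∪ K) ≤ 2 := fun h ↦ hLK (hLl.eq_of_natRk_union_le hKl h)
    have h3 := hC.inter L hL K hK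
    rw [isModularPair_iff] at h3
    have h4 : M.natRk L + M.natRk K ≠ M.natRk (L ∪ K) + M.natRk (L ∩ K) := by
      intro h
      have := hC.two_le_natRk hnp (h3 h)
      rw [isLine_iff] at hLl hKl
      omega
    rw [isLine_iff] at hLl hKl
    omega
  have hout : ∀ L ∈ C, ∀ K ∈ C, M.IsLine L → M.IsLine K → L ≠ K → ∀ q, M.IsNonloop q →
      q ∉ M.closure (L ∪ K) → ∃ J ∈ C, M.IsLine J ∧ q ∈ J := by
    intro L hL K hK hLl hKl hLK q hq hqLK
    have hs := M.subset_closure (L ∪ K) (union_subset hLl.1.subset_ground hKl.1.subset_ground)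
    have hLi := hLl.subset_closure_insert hq.mem_ground
    have hKi := hKl.subset_closure_insert hq.mem_ground
    have := hC.inter_mem
      (hC.superset L hL _ (M.isFlat_closure (insert q L)) ((subset_insert _ _).trans hLi))
      (hC.superset K hK _ (M.isFlat_closure (insert q K)) ((subset_insert _ _).trans hKi))
      (hLl.natRk_closure_insert hq.mem_ground (fun h ↦ hqLK (hs (Or.inl h))))
      (hKl.natRk_closure_insert hq.mem_ground (fun h ↦ hqLK (hs (Or.inr h))))
      (not_closure_insert_subset hLl hKl hLK hq.mem_ground hqLK)
    exact ⟨_, this.2, this.1, hLi (mem_insert _ _), hKi (mem_insert _ _)⟩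
  refine ⟨fun L hL ↦ hL.2, fun q hq ↦ ?_, fun L hL K hK q hq hqL hqK ↦ ?_, fun L hL K hK ↦ ?_⟩
  · obtain ⟨L, hL, K, hK, hLl, hKl, hLK⟩ := hC.exists_two_lines hne hnp
    by_cases hqL : q ∈ L
    · exact ⟨L, ⟨hL, hLl⟩, hqL⟩
    by_cases hqLK : q ∈ M.closure (L ∪ K)
    · have h3 := (hpair L hL K hK hLl hKl hLK).2
      obtain ⟨p, hp, hpLK⟩ := exists_notMem_of_natRk_le h3
      obtain ⟨H, hH, hHl, hpH⟩ := hout L hL K hK hLl hKl hLK p hp hpLK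
      have hs := M.subset_closure (L ∪ K) (union_subset hLl.1.subset_ground hKl.1.subset_ground)
      have hLH : L ≠ H := by
        rintro rfl
        exact hpLK (hs (Or.inl hpH))
      obtain ⟨J, hJ, hJl, hqJ⟩ := hout L hL H hH hLl hHl hLH q hq fun hqLH ↦ hpLK <|
        hLl.subset_of_mem_closure hHl.1.subset_ground
        (hpair L hL H hH hLl hHl hLH).2 (M.isFlat_closure _) (subset_union_left.trans hs)
        hqL hqLK hqLH hpH
      exact ⟨J, ⟨hJ, hJl⟩, hqJ⟩
    · obtain ⟨J, hJ, hJl, hqJ⟩ := hout L hL K hK hLl hKl hLK q hq hqLK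
      exact ⟨J, ⟨hJ, hJl⟩, hqJ⟩
  · by_contra hLK
    have h0 := (hpair L hL.1 K hK.1 hL.2 hK.2 hLK).1
    have := natRk_pos_of_mem hq (mem_inter hqL hqK)
    omega
  · by_cases hLK : L = K
    · subst hLK
      have := (isLine_iff.1 hL.2).2
      rw [union_self]
      omega
    · exact (hpair L hL.1 K hK.1 hL.2 hK.2 hLK).2

lemma isOTE_of_forall_not_isSpread (h : ∀ S, ¬ M.IsSpread S) : M.IsOTE := by
  intro C hC hne
  by_contra hnp
  exact h _ (hC.isSpread hne hnp)

/-- The flats containing some line of a spread form a modular cut. -/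
lemma IsSpread.isModularCut (hS : M.IsSpread S) :
    M.IsModularCut {F | M.IsFlat F ∧ ∃ L ∈ S, L ⊆ F} := by
  refine ⟨fun F hF ↦ hF.1, fun F ⟨_, L, hL, hLF⟩ G hG hFG ↦ ⟨hG, L, hL, hLF.trans hFG⟩, ?_⟩
  rintro F ⟨hF, L, hL, hLF⟩ G ⟨hG, K, hK, hKG⟩ hmod
  refine ⟨hF.inter hG, ?_⟩
  by_cases h0 : 1 ≤ M.natRk (F ∩ G)
  · obtain ⟨q, hqFG, hq⟩ := exists_isNonloop_mem (hF.inter hG).subset_ground h0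
    obtain ⟨J, hJ, hqJ⟩ := hS.exists_mem q hq
    exact ⟨J, hJ, subset_inter (hS.subset_of_mem hF hL hLF hq hqFG.1 hJ hqJ)
      (hS.subset_of_mem hG hK hKG hq hqFG.2 hJ hqJ)⟩
  -- Without common points, modularity gives `r(F ∪ G) = r(F) + r(G)`. But `L ⊆ F` and `K ⊆ G` are
  -- coplanar, and submodularity used twice yields `r(F ∪ G) ≤ r(F) + r(G) - 1`.
  exfalso
  rw [isModularPair_iff] at hmod
  have h1 := M.natRk_inter_add_natRk_union_le F (L ∪ K)
  have h2 := M.natRk_inter_add_natRk_union_le (F ∪ K) G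
  have h3 := M.natRk_mono (subset_inter hLF (subset_union_left (s := L) (t := K)))
  have h4 := M.natRk_mono (subset_inter (subset_union_right (s := F) (t := K)) hKG)
  have h5 := hS.natRk_union_le L hL K hK
  rw [← union_assoc, union_eq_self_of_subset_right hLF] at h1
  rw [union_assoc, union_eq_self_of_subset_left hKG] at h2
  have := (isLine_iff.1 (hS.isLine L hL)).2
  have := (isLine_iff.1 (hS.isLine K hK)).2
  omega

/-- If the cut of the spread were generated by `F`, then `F` would contain a line of the spread and
lie in all of them, so the spread would have only one line and miss the points off it. -/
lemma IsOTE.not_isSpread (hM : M.IsOTE) (S : Set (Set α)) : ¬ M.IsSpread S := by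
  intro hS
  obtain ⟨L, hL, -⟩ := hS.exists_subset_ground
  obtain ⟨F, hF, hSF⟩ := hM _ hS.isModularCut ⟨L, (hS.isLine L hL).1, L, hL, Subset.rfl⟩
  have hFL : ∀ L ∈ S, F ⊆ L := by
    intro L hL
    have : L ∈ M.principalModularCut F := hSF ▸ ⟨(hS.isLine L hL).1, L, hL, Subset.rfl⟩
    exact this.2
  obtain ⟨-, K, hK, hKF⟩ : F ∈ {F | M.IsFlat F ∧ ∃ L ∈ S, L ⊆ F} := hSF ▸ ⟨hF, Subset.rfl⟩
  have hK2 := isLine_iff.1 (hS.isLine K hK)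
  obtain ⟨q, hq, hqK⟩ := exists_notMem_of_natRk_le (M := M) (X := K) (by omega)
  rw [hK2.1.closure] at hqK
  obtain ⟨J, hJ, hqJ⟩ := hS.exists_mem q hq
  exact hqK ((hS.isLine K hK).eq_of_subset (hS.isLine J hJ) (hKF.trans (hFL J hJ)) ▸ hqJ)

end ModularCut

/-! ### The bundle condition, spreads and modularity. -/

/-- Two coplanar lines without a common point. -/
structure CoplanarDisjoint {α : Type*} (M : Matroid α) (A B : Set α) : Prop where
  left : M.IsLine A
  right : M.IsLine B
  natRk_union_le : M.natRk (A ∪ B) ≤ 3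
  inter_subset : A ∩ B ⊆ M.loops

/-- A line that is coplanar with each of `A` and `B`, but not contained in the plane of `A` and
`B`. -/
structure IsTransversal {α : Type*} (M : Matroid α) (A B J : Set α) : Prop where
  isLine : M.IsLine J
  natRk_left : M.natRk (A ∪ J) ≤ 3
  natRk_right : M.natRk (B ∪ J) ≤ 3
  not_subset : ¬ J ⊆ M.closure (A ∪ B)

section Bundle

variable {α : Type*} {M : Matroid α} {A B C D J K : Set α} {q : α}

lemma CoplanarDisjoint.symm (h : M.CoplanarDisjoint A B) : M.CoplanarDisjoint B A :=
  ⟨h.right, h.left, by rw [union_comm]; exact h.natRk_union_le,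
    by rw [inter_comm]; exact h.inter_subset⟩

lemma IsTransversal.symm (h : M.IsTransversal A B J) : M.IsTransversal B A J :=
  ⟨h.isLine, h.natRk_right, h.natRk_left, by rw [union_comm]; exact h.not_subset⟩

lemma CoplanarDisjoint.subset_closure (h : M.CoplanarDisjoint A B) :
    A ∪ B ⊆ M.closure (A ∪ B) :=
  M.subset_closure _ (union_subset h.left.1.subset_ground h.right.1.subset_ground)

variable [M.HypermodularRankFour]

/-- The bundle condition for four named lines, in terms of ranks, with `C` and `D` as the sixth
pair. -/
lemma BundleCondition.natRk_union_le (hM : M.BundleCondition)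
    (hA : M.IsLine A) (hB : M.IsLine B) (hC : M.IsLine C) (hD : M.IsLine D)
    (dAB : A ∩ B ⊆ M.loops) (dAC : A ∩ C ⊆ M.loops) (dAD : A ∩ D ⊆ M.loops)
    (dBC : B ∩ C ⊆ M.loops) (dBD : B ∩ D ⊆ M.loops) (dCD : C ∩ D ⊆ M.loops)
    (hABC : 4 ≤ M.natRk (A ∪ B ∪ C)) (hABD : 4 ≤ M.natRk (A ∪ B ∪ D))
    (hACD : 4 ≤ M.natRk (A ∪ C ∪ D)) (hBCD : 4 ≤ M.natRk (B ∪ C ∪ D))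
    (hAB : M.natRk (A ∪ B) ≤ 3) (hAC : M.natRk (A ∪ C) ≤ 3) (hAD : M.natRk (A ∪ D) ≤ 3)
    (hBC : M.natRk (B ∪ C) ≤ 3) (hBD : M.natRk (B ∪ D) ≤ 3) : M.natRk (C ∪ D) ≤ 3 := by
  have hAE := hA.1.subset_ground
  have hBE := hB.1.subset_ground
  have hCE := hC.1.subset_ground
  have hDE := hD.1.subset_ground
  rw [← coplanar_iff (union_subset (by assumption) (by assumption))] at hAB hAC hAD hBC hBD ⊢
  have aux : ∀ {X}, X ⊆ M.E → 4 ≤ M.natRk X → ¬ M.Coplanar X := fun hX h h' ↦ by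
    rw [coplanar_iff hX] at h'
    omega
  have nABC := aux (union_subset (union_subset hAE hBE) hCE) hABC
  have nABD := aux (union_subset (union_subset hAE hBE) hDE) hABD
  have nACD := aux (union_subset (union_subset hAE hCE) hDE) hACD
  have nBCD := aux (union_subset (union_subset hBE hCE) hDE) hBCD
  refine hM ![A, B, C, D] ?_ ?_ ?_ ⟨2, 3, by decide, ?_⟩ 2 3 (by decide)
  · intro i
    fin_cases i <;> assumption
  · intro i j hij
    fin_cases i <;> fin_cases j <;> first | exact absurd hij (by decide) | assumption
  · intro i j k hij hjk
    fin_cases i <;> fin_cases j <;>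
      first
      | exact absurd hij (by decide)
      | (fin_cases k <;> first | exact absurd hjk (by decide) | assumption)
  · intro i j hij hne
    fin_cases i <;> fin_cases j <;>
      first | exact absurd hij (by decide) | exact absurd rfl hne | assumption

lemma CoplanarDisjoint.ne (h : M.CoplanarDisjoint A B) : A ≠ B := by
  rintro rfl
  obtain ⟨q, hq, hq'⟩ := h.left.exists_mem
  exact hq'.not_isLoop (h.inter_subset ⟨hq, hq⟩)

lemma CoplanarDisjoint.natRk_eq (h : M.CoplanarDisjoint A B) : M.natRk (A ∪ B) = 3 := by
  have h1 := h.natRk_union_le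
  have h2 : ¬ M.natRk (A ∪ B) ≤ 2 := fun h' ↦ h.ne (h.left.eq_of_natRk_union_le h.right h')
  omega

/-- A point of `J` in the plane of `A` and `B` must lie on `A`, as otherwise the plane would contain
`J`; likewise it lies on `B`. But `A` and `B` have no common point. -/
lemma IsTransversal.notMem (h : M.IsTransversal A B J) (hAB : M.CoplanarDisjoint A B)
    (hq : M.IsNonloop q) (hqJ : q ∈ J) : q ∉ M.closure (A ∪ B) := by
  intro hqP
  have key : ∀ {A B}, M.CoplanarDisjoint A B → M.IsTransversal A B J →
      q ∈ M.closure (A ∪ B) → q ∈ A := by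
    intro A B hAB h hqP
    by_contra hqA
    exact h.not_subset <| hAB.left.subset_of_mem_closure h.isLine.1.subset_ground
      h.natRk_left (M.isFlat_closure _) (subset_union_left.trans hAB.subset_closure) hqA hqP
      (M.mem_closure_of_mem' (Or.inr hqJ) hq.mem_ground)
  exact hq.not_isLoop (hAB.inter_subset ⟨key hAB h hqP,
    key hAB.symm h.symm (by rwa [union_comm])⟩)

lemma IsTransversal.coplanarDisjoint (h : M.IsTransversal A B J) (hAB : M.CoplanarDisjoint A B) :
    M.CoplanarDisjoint A J := by
  refine ⟨hAB.left, h.isLine, h.natRk_left, fun q hq ↦ ?_⟩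
  by_contra hql
  have hq' := (isFlat_loops M).isNonloop_of_notMem (hAB.left.1.subset_ground hq.1) hql
  exact h.notMem hAB hq' hq.2 (hAB.subset_closure (Or.inl hq.1))

lemma IsTransversal.natRk_eq (h : M.IsTransversal A B J) (hAB : M.CoplanarDisjoint A B) :
    4 ≤ M.natRk (A ∪ B ∪ J) := by
  obtain ⟨q, hqJ, hq⟩ := Set.not_subset.1 h.not_subset
  have h1 := natRk_insert_eq (h.isLine.1.subset_ground hqJ) hq
  have h2 := M.natRk_mono (show insert q (A ∪ B) ⊆ A ∪ B ∪ J from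
    insert_subset (Or.inr hqJ) subset_union_left)
  have := hAB.natRk_eq
  omega

/-- As for spreads, a transversal is determined by any one of its points. -/
lemma IsTransversal.eq_inter (h : M.IsTransversal A B J) (hAB : M.CoplanarDisjoint A B)
    (hq : M.IsNonloop q) (hqJ : q ∈ J) :
    J = M.closure (insert q A) ∩ M.closure (insert q B) := by
  have hqP := h.notMem hAB hq hqJ
  refine h.isLine.eq_of_subset
    (isLine_inter_of_notMem hAB.left hAB.right hAB.ne hq.mem_ground hqP) ?_
  have key : ∀ {A}, M.IsLine A → M.natRk (A ∪ J) ≤ 3 → q ∉ A → J ⊆ M.closure (insert q A) := by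
    intro A hA hAJ hqA
    have hi := hA.subset_closure_insert hq.mem_ground
    exact hA.subset_of_mem_closure h.isLine.1.subset_ground hAJ (M.isFlat_closure _)
      ((subset_insert _ _).trans hi) hqA (hi (mem_insert _ _))
      (M.mem_closure_of_mem' (Or.inr hqJ) hq.mem_ground)
  exact subset_inter (key hAB.left h.natRk_left fun h ↦ hqP (hAB.subset_closure (Or.inl h)))
    (key hAB.right h.natRk_right fun h ↦ hqP (hAB.subset_closure (Or.inr h)))

lemma CoplanarDisjoint.exists_isTransversal (hAB : M.CoplanarDisjoint A B)
    (hq : M.IsNonloop q) (hqP : q ∉ M.closure (A ∪ B)) :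
    ∃ J, M.IsTransversal A B J ∧ q ∈ J := by
  have hA := hAB.left.subset_closure_insert hq.mem_ground
  have hB := hAB.right.subset_closure_insert hq.mem_ground
  have hqJ : q ∈ M.closure (insert q A) ∩ M.closure (insert q B) :=
    ⟨hA (mem_insert _ _), hB (mem_insert _ _)⟩
  have key : ∀ {A}, M.IsLine A → q ∉ A → ∀ X ⊆ M.closure (insert q A),
      M.natRk (A ∪ X) ≤ 3 := by
    intro A hA hqA X hX
    rw [← hA.natRk_closure_insert hq.mem_ground hqA]
    exact M.natRk_mono (union_subset
      ((subset_insert q A).trans (hA.subset_closure_insert hq.mem_ground)) hX)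
  exact ⟨_, ⟨isLine_inter_of_notMem hAB.left hAB.right hAB.ne hq.mem_ground hqP,
    key hAB.left (fun h ↦ hqP (hAB.subset_closure (Or.inl h))) _ inter_subset_left,
    key hAB.right (fun h ↦ hqP (hAB.subset_closure (Or.inr h))) _ inter_subset_right,
    fun h ↦ hqP (h hqJ)⟩, hqJ⟩

/-- If `J` and `K` were not coplanar, they would be disjoint, since transversals sharing a point are
equal. The bundle condition for `A`, `B`, `J`, `K` then applies, with `J`, `K` the only pair in
question. -/
lemma IsTransversal.natRk_union_le (hM : M.BundleCondition) (hAB : M.CoplanarDisjoint A B)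
    (hJ : M.IsTransversal A B J) (hK : M.IsTransversal A B K) : M.natRk (J ∪ K) ≤ 3 := by
  by_contra! hlt
  have hJK : J ∩ K ⊆ M.loops := by
    intro q hq
    by_contra hql
    have hq' := (isFlat_loops M).isNonloop_of_notMem (hJ.isLine.1.subset_ground hq.1) hql
    have : J = K := (hJ.eq_inter hAB hq' hq.1).trans (hK.eq_inter hAB hq' hq.2).symm
    rw [this, union_self, (isLine_iff.1 hK.isLine).2] at hlt
    omega
  have h4 : ∀ X, 4 ≤ M.natRk (X ∪ J ∪ K) := fun X ↦
    Nat.le_trans hlt (M.natRk_mono (union_subset_union_left K subset_union_right))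
  have := hM.natRk_union_le hAB.left hAB.right hJ.isLine hK.isLine hAB.inter_subset
    (hJ.coplanarDisjoint hAB).inter_subset (hK.coplanarDisjoint hAB).inter_subset
    (hJ.symm.coplanarDisjoint hAB.symm).inter_subset
    (hK.symm.coplanarDisjoint hAB.symm).inter_subset hJK
    (hJ.natRk_eq hAB) (hK.natRk_eq hAB) (h4 A) (h4 B) hAB.natRk_union_le hJ.natRk_left
    hK.natRk_left hJ.natRk_right hK.natRk_right
  omega

lemma IsTransversal.rotate (hC : M.IsTransversal A B C) (hAB : M.CoplanarDisjoint A B) :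
    M.IsTransversal A C B := by
  refine ⟨hAB.right, hAB.natRk_union_le, by rw [union_comm]; exact hC.natRk_right, fun hsub ↦ ?_⟩
  have hAC := hC.coplanarDisjoint hAB
  have h1 := M.natRk_mono (show A ∪ B ∪ C ⊆ M.closure (A ∪ C) from
    union_subset (union_subset (subset_union_left.trans hAC.subset_closure) hsub)
      (subset_union_right.trans hAC.subset_closure))
  have h2 := hC.natRk_eq hAB
  rw [natRk_closure_eq, hAC.natRk_eq] at h1
  omega

lemma IsTransversal.closure_inter_closure (hC : M.IsTransversal A B C)
    (hAB : M.CoplanarDisjoint A B) : M.closure (A ∪ C) ∩ M.closure (A ∪ B) = A := by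
  have hAC := hC.coplanarDisjoint hAB
  exact (M.isFlat_closure _).inter_eq_of_isLine (by rw [natRk_closure_eq, hAC.natRk_eq])
    (M.isFlat_closure _)
    (fun h ↦ hC.not_subset ((subset_union_right.trans hAC.subset_closure).trans h)) hAB.left
    (subset_union_left.trans hAC.subset_closure) (subset_union_left.trans hAB.subset_closure)

/-- `A`, `B`, `C` play symmetric roles: each is a transversal of the other two. Their three planes
share no point, so every point lies off one of them and is on a unique transversal of that pair; the
bundle condition makes it coplanar with the third line. -/
lemma BundleCondition.isSpread (hM : M.BundleCondition) (hAB : M.CoplanarDisjoint A B)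
    (hC : M.IsTransversal A B C) :
    M.IsSpread {J | M.IsLine J ∧ M.natRk (A ∪ J) ≤ 3 ∧ M.natRk (B ∪ J) ≤ 3 ∧
      M.natRk (C ∪ J) ≤ 3} := by
  have hAC := hC.coplanarDisjoint hAB
  have hBC := hC.symm.coplanarDisjoint hAB.symm
  have hB := hC.rotate hAB
  have hA := (hB.symm.rotate hAC.symm).symm
  have hAi := hC.closure_inter_closure hAB
  have hBi := hC.symm.closure_inter_closure hAB.symm
  rw [union_comm B A] at hBi
  have hqAB : ∀ q, M.IsNonloop q → q ∉ M.closure (A ∪ B) ∨ q ∉ M.closure (A ∪ C) ∨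
      q ∉ M.closure (B ∪ C) := by
    intro q hq
    by_contra! hcon
    exact hq.not_isLoop (hAB.inter_subset ⟨hAi.subset ⟨hcon.2.1, hcon.1⟩,
      hBi.subset ⟨hcon.2.2, hcon.1⟩⟩)
  refine ⟨fun J hJ ↦ hJ.1, fun q hq ↦ ?_, fun J hJ K hK q hq hqJ hqK ↦ ?_, fun J hJ K hK ↦ ?_⟩
  · obtain h | h | h := hqAB q hq
    · obtain ⟨J, hJ, hqJ⟩ := hAB.exists_isTransversal hq h
      exact ⟨J, ⟨hJ.isLine, hJ.natRk_left, hJ.natRk_right,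
        IsTransversal.natRk_union_le hM hAB hC hJ⟩, hqJ⟩
    · obtain ⟨J, hJ, hqJ⟩ := hAC.exists_isTransversal hq h
      exact ⟨J, ⟨hJ.isLine, hJ.natRk_left, IsTransversal.natRk_union_le hM hAC hB hJ,
        hJ.natRk_right⟩, hqJ⟩
    · obtain ⟨J, hJ, hqJ⟩ := hBC.exists_isTransversal hq h
      exact ⟨J, ⟨hJ.isLine, IsTransversal.natRk_union_le hM hBC hA hJ, hJ.natRk_left,
        hJ.natRk_right⟩, hqJ⟩
  · have key : ∀ {A B}, M.CoplanarDisjoint A B → M.natRk (A ∪ J) ≤ 3 → M.natRk (B ∪ J) ≤ 3 →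
        M.natRk (A ∪ K) ≤ 3 → M.natRk (B ∪ K) ≤ 3 → q ∉ M.closure (A ∪ B) → J = K :=
      fun hAB h1 h2 h3 h4 hqP ↦
        (IsTransversal.eq_inter ⟨hJ.1, h1, h2, fun h ↦ hqP (h hqJ)⟩ hAB hq hqJ).trans
        (IsTransversal.eq_inter ⟨hK.1, h3, h4, fun h ↦ hqP (h hqK)⟩ hAB hq hqK).symm
    obtain ⟨hJl, hJA, hJB, hJC⟩ := hJ
    obtain ⟨hKl, hKA, hKB, hKC⟩ := hK
    obtain h | h | h := hqAB q hq
    · exact key hAB hJA hJB hKA hKB h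
    · exact key hAC hJA hJC hKA hKC h
    · exact key hBC hJB hJC hKB hKC h
  · obtain ⟨hJl, hJA, hJB, hJC⟩ := hJ
    obtain ⟨hKl, hKA, hKB, hKC⟩ := hK
    have hCi : M.closure (A ∪ C) ∩ M.closure (B ∪ C) = C := by
      have := hB.symm.closure_inter_closure hAC.symm
      rwa [union_comm C B, union_comm C A, inter_comm] at this
    have hABJ := fun h1 h2 ↦ IsTransversal.natRk_union_le hM hAB
      ⟨hJl, hJA, hJB, h1⟩ ⟨hKl, hKA, hKB, h2⟩
    have hACJ := fun h1 h2 ↦ IsTransversal.natRk_union_le hM hAC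
      ⟨hJl, hJA, hJC, h1⟩ ⟨hKl, hKA, hKC, h2⟩
    have hBCJ := fun h1 h2 ↦ IsTransversal.natRk_union_le hM hBC
      ⟨hJl, hJB, hJC, h1⟩ ⟨hKl, hKB, hKC, h2⟩
    have htwo : ∀ {J K}, M.IsLine J → M.natRk (A ∪ K) ≤ 3 → M.natRk (B ∪ K) ≤ 3 →
        M.natRk (C ∪ K) ≤ 3 → (J ⊆ M.closure (A ∪ B) ∧ J ⊆ M.closure (A ∪ C) ∨
          J ⊆ M.closure (A ∪ B) ∧ J ⊆ M.closure (B ∪ C) ∨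
          J ⊆ M.closure (A ∪ C) ∧ J ⊆ M.closure (B ∪ C)) → M.natRk (J ∪ K) ≤ 3 := by
      rintro J K hJ hKA hKB hKC (h | h | h)
      · rwa [hJ.eq_of_subset hAB.left (hAi ▸ subset_inter h.2 h.1)]
      · rwa [hJ.eq_of_subset hAB.right (hBi ▸ subset_inter h.2 h.1)]
      · rwa [hJ.eq_of_subset hC.isLine (hCi ▸ subset_inter h.1 h.2)]
    have hJ2 := htwo hJl hKA hKB hKC
    have hK2 := htwo hKl hJA hJB hJC
    rw [union_comm K J] at hK2
    by_contra hJK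
    -- Two transversals of the same pair are coplanar, so each of the three planes contains `J` or
    -- `K`. By pigeonhole one of these lies in two planes, hence is `A`, `B` or `C`, and is coplanar
    -- with the other after all.
    have hAB' : J ⊆ M.closure (A ∪ B) ∨ K ⊆ M.closure (A ∪ B) := by
      by_contra! h
      exact hJK (hABJ h.1 h.2)
    have hAC' : J ⊆ M.closure (A ∪ C) ∨ K ⊆ M.closure (A ∪ C) := by
      by_contra! h
      exact hJK (hACJ h.1 h.2)
    have hBC' : J ⊆ M.closure (B ∪ C) ∨ K ⊆ M.closure (B ∪ C) := by
      by_contra! h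
      exact hJK (hBCJ h.1 h.2)
    have hJ2' := mt hJ2 hJK
    have hK2' := mt hK2 hJK
    push Not at hJ2' hK2'
    obtain h1 | h1 := hAB' <;> obtain h2 | h2 := hAC'
    · exact hJ2'.1 h1 h2
    · exact hBC'.elim (hJ2'.2.1 h1) (hK2'.2.2 h2)
    · exact hBC'.elim (hJ2'.2.2 h2) (hK2'.2.1 h1)
    · exact hK2'.1 h1 h2

lemma BundleCondition.exists_isSpread (hM : M.BundleCondition) (hAB : M.CoplanarDisjoint A B) :
    ∃ S, M.IsSpread S := by
  obtain ⟨q, hq, hqP⟩ := exists_notMem_of_natRk_le hAB.natRk_union_le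
  obtain ⟨C, hC, -⟩ := hAB.exists_isTransversal hq hqP
  exact ⟨_, hM.isSpread hAB hC⟩

/-- If no two coplanar lines are disjoint, then the matroid is modular. -/
lemma isModular_of_forall_not_coplanarDisjoint (h : ∀ A B, ¬ M.CoplanarDisjoint A B) :
    M.IsModular := by
  have hline : ∀ A B, M.IsLine A → M.IsLine B → M.natRk (A ∪ B) ≤ 3 → 1 ≤ M.natRk (A ∩ B) := by
    intro A B hA hB hAB
    by_contra! h0
    exact h A B ⟨hA, hB, hAB, ((hA.1.inter hB.1).eq_loops_of_natRk (by omega)).subset⟩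
  -- A plane through `L` and a point of `P` meets `P` in a line coplanar with `L`, which `L` must
  -- meet.
  have hlp : ∀ L P, M.IsLine L → M.IsFlat P → M.natRk P = 3 → 1 ≤ M.natRk (L ∩ P) := by
    intro L P hL hP hP3
    have hL2 := (isLine_iff.1 hL).2
    by_cases hLP : L ⊆ P
    · rw [inter_eq_self_of_subset_left hLP]
      omega
    obtain ⟨y, hyP, hyL⟩ : ∃ y ∈ P, y ∉ L := by
      by_contra! hcon
      have := M.natRk_mono (show P ⊆ L from hcon)
      omega
    have hyE := hP.subset_ground hyP
    have hi := (subset_insert y L).trans (hL.subset_closure_insert hyE)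
    have hK := isLine_inter (M.isFlat_closure (insert y L)) hP (hL.natRk_closure_insert hyE hyL)
      hP3 (fun h ↦ hLP (hi.trans h))
    have h1 := hline L _ hL hK (by
      rw [← hL.natRk_closure_insert hyE hyL]
      exact M.natRk_mono (union_subset hi inter_subset_left))
    exact h1.trans (M.natRk_mono (inter_subset_inter_right _ inter_subset_right))
  intro X Y hX hY
  rw [isModularPair_iff]
  by_cases hXY : X ⊆ Y
  · rw [union_eq_self_of_subset_left hXY, inter_eq_self_of_subset_left hXY, add_comm]
  by_cases hYX : Y ⊆ X
  · rw [union_eq_self_of_subset_right hYX, inter_eq_self_of_subset_right hYX]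
  have hsub := M.natRk_inter_add_natRk_union_le X Y
  have hiX := hX.natRk_inter_lt hY hXY
  have hiY := hY.natRk_inter_lt hX hYX
  have huX := hX.natRk_lt_natRk_union hYX hY.subset_ground
  have huY := hY.natRk_lt_natRk_union hXY hX.subset_ground
  rw [union_comm] at huX
  rw [inter_comm] at hiY
  have h4 := natRk_le_four (M := M) (X ∪ Y)
  -- For incomparable flats submodularity settles rank at most 1. Otherwise the missing lower bound
  -- on `r(X ∩ Y)` comes from `hline`, `hlp` or, for two planes, hypermodularity.
  obtain hX1 | hX1 | hX1 : M.natRk X ≤ 1 ∨ M.natRk X = 2 ∨ 3 ≤ M.natRk X := by omega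
  · omega
  · obtain hY1 | hY1 | hY1 : M.natRk Y ≤ 1 ∨ M.natRk Y = 2 ∨ 3 ≤ M.natRk Y := by omega
    · omega
    · have := hline X Y (isLine_iff.2 ⟨hX, hX1⟩) (isLine_iff.2 ⟨hY, hY1⟩)
      omega
    · have := hlp X Y (isLine_iff.2 ⟨hX, hX1⟩) hY (by omega)
      omega
  · obtain hY1 | hY1 | hY1 : M.natRk Y ≤ 1 ∨ M.natRk Y = 2 ∨ 3 ≤ M.natRk Y := by omega
    · omega
    · have := hlp Y X (isLine_iff.2 ⟨hY, hY1⟩) hX (by omega)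
      rw [inter_comm] at this
      omega
    · have := two_le_natRk_inter hX hY hX1 hY1
      omega

lemma IsOTE.isModular (hM : M.IsOTE) (hb : M.BundleCondition) : M.IsModular := by
  refine isModular_of_forall_not_coplanarDisjoint fun A B hAB ↦ ?_
  obtain ⟨S, hS⟩ := hb.exists_isSpread hAB
  exact hM.not_isSpread S hS

end Bundle

/-! ### A matroid from its ranked flats. -/

/-- A family of sets with a bounded rank function, satisfying the properties of the flats of a
matroid of finite rank. -/
structure FlatFamily (β : Type*) where
  /-- The ground set. -/
  E : Set β
  /-- The flats. -/
  flats : Set (Set β)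
  /-- The rank function on flats. -/
  rk : Set β → ℕ
  subset_ground : ∀ F ∈ flats, F ⊆ E
  ground_mem : E ∈ flats
  inter_mem : ∀ F ∈ flats, ∀ G ∈ flats, F ∩ G ∈ flats
  rk_lt : ∀ F ∈ flats, ∀ G ∈ flats, F ⊂ G → rk F < rk G
  exists_rk_zero : ∃ F ∈ flats, rk F = 0
  exists_insert : ∀ F ∈ flats, ∀ e ∈ E, ∃ G ∈ flats, insert e F ⊆ G ∧ rk G ≤ rk F + 1

namespace FlatFamily

variable {β : Type*} (𝓕 : FlatFamily β) {I J X F G : Set β} {e : β}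

/-- A set is independent if it meets no flat in more elements than the rank of the flat. -/
def Indep (I : Set β) : Prop := I ⊆ 𝓕.E ∧ ∀ F ∈ 𝓕.flats, (I ∩ F).encard ≤ 𝓕.rk F

lemma eq_of_subset (hF : F ∈ 𝓕.flats) (hG : G ∈ 𝓕.flats) (h : F ⊆ G) (hr : 𝓕.rk G ≤ 𝓕.rk F) :
    F = G := by
  by_contra hne
  exact absurd (𝓕.rk_lt F hF G hG (h.ssubset_of_ne hne)) (by omega)

lemma Indep.encard_le (hI : 𝓕.Indep I) : I.encard ≤ 𝓕.rk 𝓕.E := by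
  have := hI.2 _ 𝓕.ground_mem
  rwa [inter_eq_self_of_subset_left hI.1] at this

/-- For independent `I` the rank bound is an equality, so this flat will be the closure of `I`. -/
lemma exists_superset (hI : I.Finite) (hIE : I ⊆ 𝓕.E) :
    ∃ F ∈ 𝓕.flats, I ⊆ F ∧ (𝓕.rk F : ℕ∞) ≤ I.encard := by
  induction I, hI using Set.Finite.induction_on with
  | empty =>
    obtain ⟨F, hF, h0⟩ := 𝓕.exists_rk_zero
    exact ⟨F, hF, empty_subset F, by simp [h0]⟩
  | @insert e I he _ ih =>
    rw [insert_subset_iff] at hIE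
    obtain ⟨F, hF, hIF, hr⟩ := ih hIE.2
    obtain ⟨G, hG, hFG, hr'⟩ := 𝓕.exists_insert F hF e hIE.1
    refine ⟨G, hG, (insert_subset_insert hIF).trans hFG, ?_⟩
    rw [encard_insert_of_notMem he]
    calc (𝓕.rk G : ℕ∞) ≤ (𝓕.rk F : ℕ∞) + 1 := by exact_mod_cast hr'
      _ ≤ _ := by gcongr

/-- If a flat `G` contains `e`, then `F ∩ G` is a proper subflat that already contains `I ∩ G`, and
the strict increase of `rk` makes room for `e`. -/
lemma Indep.insert (hI : 𝓕.Indep I) (hF : F ∈ 𝓕.flats) (hIF : I ⊆ F)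
    (he : e ∈ 𝓕.E) (heF : e ∉ F) : 𝓕.Indep (insert e I) := by
  refine ⟨insert_subset he hI.1, fun G hG ↦ ?_⟩
  by_cases heG : e ∈ G
  · rw [insert_inter_of_mem heG, encard_insert_of_notMem fun h ↦ heF (hIF h.1)]
    have hle := hI.2 _ (𝓕.inter_mem F hF G hG)
    rw [← inter_assoc, inter_eq_self_of_subset_left hIF] at hle
    have hlt := 𝓕.rk_lt _ (𝓕.inter_mem F hF G hG) G hG
      (inter_subset_right.ssubset_of_ne fun h ↦ heF (h.ge heG).1)
    calc (I ∩ G).encard + 1 ≤ (𝓕.rk (F ∩ G) : ℕ∞) + 1 := by gcongr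
      _ ≤ 𝓕.rk G := by exact_mod_cast hlt
  · rw [insert_inter_of_notMem heG]
    exact hI.2 G hG

/-- The matroid of a family of flats. -/
def matroid : Matroid β :=
  (IndepMatroid.ofBddAugment 𝓕.E 𝓕.Indep ⟨empty_subset _, fun F _ ↦ by simp⟩
    (fun I J hJ hIJ ↦ ⟨hIJ.trans hJ.1, fun F hF ↦
      (encard_le_encard (inter_subset_inter_left F hIJ)).trans (hJ.2 F hF)⟩)
    (fun I J hI hJ hlt ↦ by
      -- A flat around `I` of rank at most `|I|` cannot contain the larger independent set `J`; any
      -- element of `J` outside it augments `I`.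
      obtain ⟨F, hF, hIF, hr⟩ := 𝓕.exists_superset
        (finite_of_encard_le_coe hI.encard_le) hI.1
      obtain ⟨e, heJ, heF⟩ : ∃ e ∈ J, e ∉ F := by
        by_contra! hcon
        have := hJ.2 F hF
        rw [inter_eq_self_of_subset_left hcon] at this
        exact (hlt.trans_le (this.trans hr)).false
      exact ⟨e, heJ, fun h ↦ heF (hIF h), hI.insert 𝓕 hF hIF (hJ.1 heJ) heF⟩)
    ⟨_, fun I hI ↦ hI.encard_le⟩ fun I hI ↦ hI.1).matroid

lemma matroid_indep_iff : 𝓕.matroid.Indep I ↔ 𝓕.Indep I := Iff.rfl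

instance : 𝓕.matroid.RankFinite :=
  IndepMatroid.ofBddAugment_rankFinite ..

/-- Let `G` be a flat of rank `|I|` around a basis `I` of `X`. Elements outside `G` extend `I`, and
elements of `G` outside `I` cannot, by counting in `G`. -/
lemma exists_closure (hX : X ⊆ 𝓕.E) :
    ∃ G ∈ 𝓕.flats, 𝓕.matroid.closure X = G ∧ 𝓕.matroid.natRk X = 𝓕.rk G := by
  obtain ⟨I, hI⟩ := 𝓕.matroid.exists_isBasis X hX
  have hIi : 𝓕.Indep I := hI.indep
  have hfin : I.Finite := finite_of_encard_le_coe hIi.encard_le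
  obtain ⟨G, hG, hIG, hr⟩ := 𝓕.exists_superset hfin hIi.1
  have hle := hIi.2 G hG
  rw [inter_eq_self_of_subset_left hIG] at hle
  refine ⟨G, hG, ?_, ?_⟩
  · rw [← hI.closure_eq_closure]
    ext e
    constructor
    · intro he
      by_contra heG
      have heE := mem_ground_of_mem_closure he
      have := hIi.insert 𝓕 hG hIG heE heG
      exact heG (hIG ((hI.indep.mem_closure_iff'.1 he).2 this))
    · intro he
      refine hI.indep.mem_closure_iff'.2 ⟨𝓕.subset_ground G hG he, fun hins ↦ ?_⟩
      by_contra heI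
      have := hins.2 G hG
      rw [inter_eq_self_of_subset_left (insert_subset he hIG),
        encard_insert_of_notMem heI] at this
      have h2 := this.trans hr
      rw [ENat.add_one_le_iff hfin.encard_lt_top.ne] at h2
      exact h2.false
  · have := hI.encard_eq_eRk
    rw [← eRk_eq_coe_iff, ← this]
    exact hle.antisymm hr

lemma matroid_isFlat_iff : 𝓕.matroid.IsFlat F ↔ F ∈ 𝓕.flats := by
  refine ⟨fun h ↦ ?_, fun h ↦ ?_⟩
  · obtain ⟨G, hG, h1, -⟩ := 𝓕.exists_closure h.subset_ground
    rwa [← h.closure, h1]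
  · obtain ⟨G, hG, h1, h2⟩ := 𝓕.exists_closure (𝓕.subset_ground F h)
    have hFG : F ⊆ G := h1 ▸ 𝓕.matroid.subset_closure F (𝓕.subset_ground F h)
    have hle : 𝓕.matroid.natRk F ≤ 𝓕.rk F := by
      rw [← Nat.cast_le (α := ℕ∞), coe_natRk, eRk_le_iff]
      intro I hIF hI
      have := hI.2 F h
      rwa [inter_eq_self_of_subset_left hIF] at this
    rw [isFlat_iff_closure_eq, h1, 𝓕.eq_of_subset h hG hFG (by omega)]

lemma natRk_eq (hF : F ∈ 𝓕.flats) : 𝓕.matroid.natRk F = 𝓕.rk F := by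
  obtain ⟨G, -, h1, h2⟩ := 𝓕.exists_closure (𝓕.subset_ground F hF)
  rw [(𝓕.matroid_isFlat_iff.2 hF).closure] at h1
  rw [h2, h1]

end FlatFamily

/-! ### Compatible spreads and the flats of the extension. -/

/-- A set of spreads such that any two of them have a line in common. -/
structure IsCompatible {α : Type*} (M : Matroid α) (𝒞 : Set (Set (Set α))) : Prop where
  isSpread : ∀ C ∈ 𝒞, M.IsSpread C
  exists_common : ∀ C ∈ 𝒞, ∀ D ∈ 𝒞, ∃ L ∈ C, L ∈ D

/-- Compatibility is a condition on pairs of spreads, so it passes to unions of chains. -/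
lemma exists_maximal_isCompatible {α : Type*} (M : Matroid α) :
    ∃ 𝒞, Maximal M.IsCompatible 𝒞 := by
  refine zorn_subset {𝒞 | M.IsCompatible 𝒞} fun c hc hchain ↦
    ⟨⋃₀ c, ⟨?_, ?_⟩, fun s hs ↦ subset_sUnion_of_mem hs⟩
  · rintro C ⟨s, hs, hC⟩
    exact (hc hs).isSpread C hC
  · rintro C ⟨s, hs, hC⟩ D ⟨t, ht, hD⟩
    obtain h | h := hchain.total hs ht
    · exact (hc ht).exists_common C (h hC) D hD
    · exact (hc hs).exists_common C hC D (h hD)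

/-- The extension of a flat `F` by the spreads with a line in `F`. -/
def spreadExt {α : Type*} (𝒞 : Set (Set (Set α))) (F : Set α) : Set (α ⊕ Set (Set α)) :=
  Sum.inl '' F ∪ Sum.inr '' {C ∈ 𝒞 | ∃ L ∈ C, L ⊆ F}

/-- The flat of rank one consisting of a spread and all loops. -/
def spreadPoint {α : Type*} (M : Matroid α) (C : Set (Set α)) : Set (α ⊕ Set (Set α)) :=
  Sum.inl '' M.loops ∪ {Sum.inr C}

open Classical in
/-- The rank of an extended flat. -/
noncomputable def spreadRk {α : Type*} (M : Matroid α) (X : Set (α ⊕ Set (Set α))) : ℕ :=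
  -- The second term matters only for a `spreadPoint`: an extended flat containing a spread contains
  -- one of its lines and has rank at least 2 anyway.
  max (M.natRk (Sum.inl ⁻¹' X)) (if ∃ C, Sum.inr C ∈ X then 1 else 0)

section Extension

variable {α : Type*} {M : Matroid α} {𝒞 : Set (Set (Set α))} {C D : Set (Set α)}
  {F G L K P Q : Set α} {x q : α}

@[simp] lemma inl_mem_spreadExt : Sum.inl x ∈ spreadExt 𝒞 F ↔ x ∈ F := by
  simp [spreadExt]

@[simp] lemma inr_mem_spreadExt :
    Sum.inr C ∈ spreadExt 𝒞 F ↔ C ∈ 𝒞 ∧ ∃ L ∈ C, L ⊆ F := by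
  simp [spreadExt]

@[simp] lemma inl_mem_spreadPoint : Sum.inl x ∈ M.spreadPoint C ↔ x ∈ M.loops := by
  simp [spreadPoint]

@[simp] lemma inr_mem_spreadPoint : Sum.inr D ∈ M.spreadPoint C ↔ D = C := by
  simp [spreadPoint]

@[simp] lemma preimage_spreadExt : Sum.inl ⁻¹' spreadExt 𝒞 F = F := by
  ext; simp

lemma preimage_spreadPoint : Sum.inl ⁻¹' M.spreadPoint C = M.loops := by
  ext; simp

lemma spreadExt_mono (h : F ⊆ G) : spreadExt 𝒞 F ⊆ spreadExt 𝒞 G := by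
  rintro (x | C) hx
  · simp only [inl_mem_spreadExt] at hx ⊢
    exact h hx
  · simp only [inr_mem_spreadExt] at hx ⊢
    obtain ⟨hC, L, hL, hLF⟩ := hx
    exact ⟨hC, L, hL, hLF.trans h⟩

lemma spreadRk_spreadPoint : M.spreadRk (M.spreadPoint C) = 1 := by
  simp [spreadRk, preimage_spreadPoint, natRk_loops]

variable [M.HypermodularRankFour]

lemma IsSpread.two_le_natRk (hC : M.IsSpread C) (hL : L ∈ C) (h : L ⊆ F) : 2 ≤ M.natRk F := by
  rw [← (isLine_iff.1 (hC.isLine L hL)).2]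
  exact M.natRk_mono h

lemma IsCompatible.spreadRk_spreadExt (h𝒞 : M.IsCompatible 𝒞) (F : Set α) :
    M.spreadRk (spreadExt 𝒞 F) = M.natRk F := by
  rw [spreadRk, preimage_spreadExt]
  refine max_eq_left ?_
  split_ifs with h
  · obtain ⟨C, hC⟩ := h
    obtain ⟨hC, L, hL, hLF⟩ := inr_mem_spreadExt.1 hC
    have := (h𝒞.isSpread C hC).two_le_natRk hL hLF
    omega
  · exact Nat.zero_le _

/-- Two different spreads cannot both have lines in each of two flats that meet in loops only. -/
lemma IsSpread.eq_of_natRk_inter (hC : M.IsSpread C) (hD : M.IsSpread D) (hF : M.IsFlat F)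
    (hG : M.IsFlat G) (h0 : M.natRk (F ∩ G) = 0) (hCF : ∃ L ∈ C, L ⊆ F) (hCG : ∃ L ∈ C, L ⊆ G)
    (hDF : ∃ L ∈ D, L ⊆ F) (hDG : ∃ L ∈ D, L ⊆ G) : C = D := by
  -- Two flats of rank at least 3 would share a line. So one of them, say `F`, is a line, and it
  -- belongs to both spreads.
  wlog hF2 : M.natRk F ≤ 2 generalizing F G
  · refine this hG hF (by rwa [inter_comm]) hCG hCF hDG hDF ?_
    by_contra! hG3
    have := two_le_natRk_inter hF hG (by omega) hG3
    omega
  obtain ⟨L, hL, hLF⟩ := hCF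
  obtain ⟨L', hL', hLF'⟩ := hDF
  obtain ⟨K, hK, hKG⟩ := hCG
  obtain ⟨K', hK', hKG'⟩ := hDG
  have hFl : M.IsLine F := isLine_iff.2 ⟨hF, by
    have := hC.two_le_natRk hL hLF
    omega⟩
  obtain rfl := (hC.isLine L hL).eq_of_subset hFl hLF
  obtain rfl := (hD.isLine L' hL').eq_of_subset hFl hLF'
  obtain ⟨q, hqK', hq⟩ := (hD.isLine K' hK').exists_mem
  have hqL : q ∉ L' := fun hqL ↦ by
    have := natRk_pos_of_mem hq (mem_inter hqL (hKG' hqK'))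
    omega
  obtain ⟨J, hJ, hqJ⟩ := hC.exists_mem q hq
  have hi := hFl.subset_closure_insert hq.mem_ground
  have hi' := (subset_insert q L').trans hi
  have hqi := hi (mem_insert q L')
  -- The plane of `L'` and `q` meets `G` in rank at most 2. The lines of both spreads through `q`
  -- lie there and coincide, which gives a second common line.
  have hlt := (M.isFlat_closure (insert q L')).natRk_inter_lt hG fun h ↦ by
    rw [inter_eq_self_of_subset_left (hi'.trans h), (isLine_iff.1 hFl).2] at h0
    omega
  rw [hFl.natRk_closure_insert hq.mem_ground hqL] at hlt
  have key : ∀ J, M.IsLine J → J ⊆ M.closure (insert q L') ∩ G →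
      J = M.closure (insert q L') ∩ G := fun J hJ hsub ↦ by
    rw [isLine_iff] at hJ
    exact hJ.1.eq_of_subset_of_natRk_le ((M.isFlat_closure _).inter hG) hsub (by omega)
  have hJ' := key J (hC.isLine J hJ) (subset_inter
    (hC.subset_of_mem (M.isFlat_closure _) hL hi' hq hqi hJ hqJ)
    (hC.subset_of_mem hG hK hKG hq (hKG' hqK') hJ hqJ))
  have hK'' := key K' (hD.isLine K' hK') (subset_inter
    (hD.subset_of_mem (M.isFlat_closure _) hL' hi' hq hqi hK' hqK') hKG')
  obtain rfl := hJ'.trans hK''.symm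
  exact hC.eq_of_two hD hL hJ (fun h ↦ hqL (h ▸ hqJ)) hL' hK'

/-- The exception is a spread `C` with lines in `F` and in `G` but none in `F ∩ G`. Then `F ∩ G` has
no point, as the line of `C` through it would lie in both, and `C` is the only spread of `𝒞` with
lines in both flats by `IsSpread.eq_of_natRk_inter`. -/
lemma IsCompatible.spreadExt_inter (h𝒞 : M.IsCompatible 𝒞) (hF : M.IsFlat F) (hG : M.IsFlat G) :
    spreadExt 𝒞 F ∩ spreadExt 𝒞 G = spreadExt 𝒞 (F ∩ G) ∨
      ∃ C ∈ 𝒞, spreadExt 𝒞 F ∩ spreadExt 𝒞 G = M.spreadPoint C := by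
  by_cases h : ∃ C ∈ 𝒞, (∃ L ∈ C, L ⊆ F) ∧ (∃ L ∈ C, L ⊆ G) ∧ ¬ ∃ L ∈ C, L ⊆ F ∩ G
  · obtain ⟨C, hC, hCF, hCG, hCFG⟩ := h
    have hCs := h𝒞.isSpread C hC
    have h0 : M.natRk (F ∩ G) = 0 := by
      by_contra h0
      obtain ⟨q, hqFG, hq⟩ := exists_isNonloop_mem (hF.inter hG).subset_ground
        (Nat.one_le_iff_ne_zero.2 h0)
      obtain ⟨J, hJ, hqJ⟩ := hCs.exists_mem q hq
      obtain ⟨L, hL, hLF⟩ := hCF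
      obtain ⟨K, hK, hKG⟩ := hCG
      exact hCFG ⟨J, hJ, subset_inter (hCs.subset_of_mem hF hL hLF hq hqFG.1 hJ hqJ)
        (hCs.subset_of_mem hG hK hKG hq hqFG.2 hJ hqJ)⟩
    refine Or.inr ⟨C, hC, ?_⟩
    ext (x | D)
    · simp only [mem_inter_iff, inl_mem_spreadExt, inl_mem_spreadPoint]
      rw [← (hF.inter hG).eq_loops_of_natRk h0, mem_inter_iff]
    · simp only [mem_inter_iff, inr_mem_spreadExt, inr_mem_spreadPoint]
      constructor
      · rintro ⟨⟨hD, hDF⟩, -, hDG⟩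
        exact (h𝒞.isSpread D hD).eq_of_natRk_inter hCs hF hG h0 hDF hDG hCF hCG
      · rintro rfl
        exact ⟨⟨hC, hCF⟩, hC, hCG⟩
  · push Not at h
    refine Or.inl ?_
    ext (x | D)
    · simp
    · simp only [mem_inter_iff, inr_mem_spreadExt]
      constructor
      · rintro ⟨⟨hD, hDF⟩, -, hDG⟩
        exact ⟨hD, h D hD hDF hDG⟩
      · rintro ⟨hD, L, hL, hLFG⟩
        exact ⟨⟨hD, L, hL, hLFG.trans inter_subset_left⟩, hD, L, hL,
          hLFG.trans inter_subset_right⟩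

lemma IsCompatible.spreadPoint_inter (h𝒞 : M.IsCompatible 𝒞) {X : Set (α ⊕ Set (Set α))}
    (hX : Sum.inl '' M.loops ⊆ X) : M.spreadPoint C ∩ X = M.spreadPoint C ∨
      M.spreadPoint C ∩ X = spreadExt 𝒞 M.loops := by
  have hl : spreadExt 𝒞 M.loops = Sum.inl '' M.loops := by
    ext (x | D)
    · simp
    · simp only [inr_mem_spreadExt, mem_image, reduceCtorEq, and_false, exists_false, iff_false]
      rintro ⟨hD, L, hL, hLl⟩
      have := (h𝒞.isSpread D hD).two_le_natRk hL hLl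
      rw [natRk_loops] at this
      omega
  rw [hl]
  by_cases hC : Sum.inr C ∈ X
  · exact Or.inl (inter_eq_left.2 (union_subset hX (singleton_subset_iff.2 hC)))
  · refine Or.inr ?_
    rw [spreadPoint, union_inter_distrib_right, inter_eq_self_of_subset_left hX,
      singleton_inter_eq_empty.2 hC, union_empty]

/-- The flats of the extension of `M` by a compatible set of spreads. -/
noncomputable def IsCompatible.flatFamily (h𝒞 : M.IsCompatible 𝒞) :
    FlatFamily (α ⊕ Set (Set α)) where
  E := spreadExt 𝒞 M.E
  flats := {X | (∃ F, M.IsFlat F ∧ X = spreadExt 𝒞 F) ∨ ∃ C ∈ 𝒞, X = M.spreadPoint C}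
  rk := M.spreadRk
  subset_ground := by
    rintro _ (⟨F, hF, rfl⟩ | ⟨C, hC, rfl⟩)
    · exact spreadExt_mono hF.subset_ground
    · obtain ⟨L, hL, hLE⟩ := (h𝒞.isSpread C hC).exists_subset_ground
      rintro (x | D) hx
      · simp only [inl_mem_spreadPoint, inl_mem_spreadExt] at hx ⊢
        exact M.loops_subset_ground hx
      · simp only [inr_mem_spreadPoint, inr_mem_spreadExt] at hx ⊢
        exact hx ▸ ⟨hC, L, hL, hLE⟩
  ground_mem := Or.inl ⟨M.E, M.ground_isFlat, rfl⟩
  inter_mem := by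
    have hloops : ∀ X, ((∃ F, M.IsFlat F ∧ X = spreadExt 𝒞 F) ∨ ∃ C ∈ 𝒞, X = M.spreadPoint C) →
        Sum.inl '' M.loops ⊆ X := by
      rintro _ (⟨F, hF, rfl⟩ | ⟨C, hC, rfl⟩)
      · exact (image_mono hF.loops_subset).trans subset_union_left
      · exact subset_union_left
    have hpt : ∀ C ∈ 𝒞, ∀ X, Sum.inl '' M.loops ⊆ X →
        (∃ F, M.IsFlat F ∧ M.spreadPoint C ∩ X = spreadExt 𝒞 F) ∨
          ∃ D ∈ 𝒞, M.spreadPoint C ∩ X = M.spreadPoint D := fun C hC X hX ↦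
      (h𝒞.spreadPoint_inter hX).elim (fun h ↦ Or.inr ⟨C, hC, h⟩)
        fun h ↦ Or.inl ⟨_, isFlat_loops M, h⟩
    rintro X (⟨F, hF, rfl⟩ | ⟨C, hC, rfl⟩) Y hY
    · obtain ⟨G, hG, rfl⟩ | ⟨D, hD, rfl⟩ := hY
      · exact (h𝒞.spreadExt_inter hF hG).imp_left fun h ↦ ⟨_, hF.inter hG, h⟩
      · rw [inter_comm]
        exact hpt D hD _ (hloops _ (Or.inl ⟨F, hF, rfl⟩))
    · exact hpt C hC _ (hloops _ hY)
  rk_lt := by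
    rintro X (⟨F, hF, rfl⟩ | ⟨C, hC, rfl⟩) Y (⟨G, hG, rfl⟩ | ⟨D, hD, rfl⟩) hss
    · rw [h𝒞.spreadRk_spreadExt, h𝒞.spreadRk_spreadExt]
      refine hF.natRk_lt_of_ssubset hG (ssubset_of_subset_of_ne ?_ ?_)
      · rw [← preimage_spreadExt (𝒞 := 𝒞) (F := F), ← preimage_spreadExt (𝒞 := 𝒞) (F := G)]
        exact preimage_mono hss.subset
      · rintro rfl
        exact hss.ne rfl
    · rw [h𝒞.spreadRk_spreadExt, spreadRk_spreadPoint, natRk_eq_zero_of_subset_loops]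
      · exact one_pos
      · rw [← preimage_spreadExt (𝒞 := 𝒞) (F := F), ← preimage_spreadPoint (C := D)]
        exact preimage_mono hss.subset
    · obtain ⟨-, L, hL, hLG⟩ := inr_mem_spreadExt.1 (hss.subset (inr_mem_spreadPoint.2 rfl))
      have := (h𝒞.isSpread C hC).two_le_natRk hL hLG
      rw [h𝒞.spreadRk_spreadExt, spreadRk_spreadPoint]
      omega
    · obtain rfl := inr_mem_spreadPoint.1 (hss.subset (inr_mem_spreadPoint.2 rfl))
      exact (hss.ne rfl).elim
  exists_rk_zero :=
    ⟨_, Or.inl ⟨_, isFlat_loops M, rfl⟩, by rw [h𝒞.spreadRk_spreadExt, natRk_loops]⟩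
  exists_insert := by
    have hline : ∀ C ∈ 𝒞, ∀ L ∈ C, M.spreadPoint C ⊆ spreadExt 𝒞 L := by
      rintro C hC L hL (x | D) hx
      · simp only [inl_mem_spreadPoint, inl_mem_spreadExt] at hx ⊢
        exact ((h𝒞.isSpread C hC).isLine L hL).1.loops_subset hx
      · simp only [inr_mem_spreadPoint, inr_mem_spreadExt] at hx ⊢
        exact hx ▸ ⟨hC, L, hL, Subset.rfl⟩
    have hrk : ∀ C ∈ 𝒞, ∀ L ∈ C, M.spreadRk (spreadExt 𝒞 L) = 2 := fun C hC L hL ↦ by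
      rw [h𝒞.spreadRk_spreadExt, (isLine_iff.1 ((h𝒞.isSpread C hC).isLine L hL)).2]
    rintro X (⟨F, hF, rfl⟩ | ⟨C, hC, rfl⟩) (x | D) he
    · have hx := inl_mem_spreadExt.1 he
      have hi := M.subset_closure _ (insert_subset hx hF.subset_ground)
      refine ⟨_, Or.inl ⟨_, M.isFlat_closure (insert x F), rfl⟩, insert_subset ?_ ?_, ?_⟩
      · exact inl_mem_spreadExt.2 (hi (mem_insert _ _))
      · exact spreadExt_mono ((subset_insert _ _).trans hi)
      · rw [h𝒞.spreadRk_spreadExt, h𝒞.spreadRk_spreadExt, natRk_closure_eq]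
        exact M.natRk_insert_le x F
    · have hD := (inr_mem_spreadExt.1 he).1
      by_cases h0 : M.natRk F = 0
      · obtain rfl := hF.eq_loops_of_natRk h0
        refine ⟨_, Or.inr ⟨D, hD, rfl⟩, insert_subset (inr_mem_spreadPoint.2 rfl) ?_, ?_⟩
        · rintro (y | C) hy
          · simpa using hy
          · obtain ⟨hC, L, hL, hLl⟩ := inr_mem_spreadExt.1 hy
            have := (h𝒞.isSpread C hC).two_le_natRk hL hLl
            omega
        · rw [spreadRk_spreadPoint, h𝒞.spreadRk_spreadExt, h0]
      -- The line of `D` through a point of `F` raises the rank of `F` by at most 1 and brings in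
      -- `D`.
      · obtain ⟨q, hqF, hq⟩ := exists_isNonloop_mem hF.subset_ground
          (Nat.one_le_iff_ne_zero.2 h0)
        obtain ⟨L, hL, hqL⟩ := (h𝒞.isSpread D hD).exists_mem q hq
        have hLl := (h𝒞.isSpread D hD).isLine L hL
        have hs := M.subset_closure _ (union_subset hF.subset_ground hLl.1.subset_ground)
        refine ⟨_, Or.inl ⟨_, M.isFlat_closure (F ∪ L), rfl⟩, insert_subset ?_ ?_, ?_⟩
        · exact inr_mem_spreadExt.2 ⟨hD, L, hL, subset_union_right.trans hs⟩
        · exact spreadExt_mono (subset_union_left.trans hs)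
        · rw [h𝒞.spreadRk_spreadExt, h𝒞.spreadRk_spreadExt, natRk_closure_eq]
          have h1 := M.natRk_inter_add_natRk_union_le F L
          have h2 := natRk_pos_of_mem hq (mem_inter hqF hqL)
          have h3 := (isLine_iff.1 hLl).2
          omega
    · have hx := inl_mem_spreadExt.1 he
      by_cases hxl : x ∈ M.loops
      · exact ⟨_, Or.inr ⟨C, hC, rfl⟩, insert_subset (inl_mem_spreadPoint.2 hxl) Subset.rfl,
          Nat.le_succ _⟩
      · obtain ⟨L, hL, hxL⟩ := (h𝒞.isSpread C hC).exists_mem x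
          ((isNonloop_iff_notMem_loops hx).2 hxl)
        refine ⟨_, Or.inl ⟨L, ((h𝒞.isSpread C hC).isLine L hL).1, rfl⟩,
          insert_subset (inl_mem_spreadExt.2 hxL) (hline C hC L hL), ?_⟩
        rw [hrk C hC L hL, spreadRk_spreadPoint]
    · have hD := (inr_mem_spreadExt.1 he).1
      -- Compatibility is what provides a line joining two new points.
      obtain ⟨L, hLC, hLD⟩ := h𝒞.exists_common C hC D hD
      refine ⟨_, Or.inl ⟨L, ((h𝒞.isSpread C hC).isLine L hLC).1, rfl⟩,
        insert_subset (inr_mem_spreadExt.2 ⟨hD, L, hLD, Subset.rfl⟩) (hline C hC L hLC), ?_⟩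
      rw [hrk C hC L hLC, spreadRk_spreadPoint]

end Extension

/-! ### The extension and its properties. -/

namespace IsCompatible

variable {α : Type*} {M : Matroid α} {𝒞 : Set (Set (Set α))} {C D : Set (Set α)}
  {F G I L K P Q : Set α} {X Y : Set (α ⊕ Set (Set α))} {x q : α} [M.HypermodularRankFour]

/-- The extension of `M` by a compatible set of spreads, each of them being a new element. -/
noncomputable def extension (h𝒞 : M.IsCompatible 𝒞) : Matroid (α ⊕ Set (Set α)) :=
  h𝒞.flatFamily.matroid

variable (h𝒞 : M.IsCompatible 𝒞)

lemma extension_E : h𝒞.extension.E = spreadExt 𝒞 M.E := rfl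

instance : h𝒞.extension.RankFinite := inferInstanceAs h𝒞.flatFamily.matroid.RankFinite

lemma isFlat_extension_iff : h𝒞.extension.IsFlat X ↔
    (∃ F, M.IsFlat F ∧ X = spreadExt 𝒞 F) ∨ ∃ C ∈ 𝒞, X = M.spreadPoint C :=
  h𝒞.flatFamily.matroid_isFlat_iff

lemma isFlat_spreadExt (hF : M.IsFlat F) : h𝒞.extension.IsFlat (spreadExt 𝒞 F) :=
  h𝒞.isFlat_extension_iff.2 (Or.inl ⟨F, hF, rfl⟩)

lemma natRk_spreadExt (hF : M.IsFlat F) : h𝒞.extension.natRk (spreadExt 𝒞 F) = M.natRk F :=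
  (h𝒞.flatFamily.natRk_eq (Or.inl ⟨F, hF, rfl⟩)).trans (h𝒞.spreadRk_spreadExt F)

lemma natRk_spreadPoint (hC : C ∈ 𝒞) : h𝒞.extension.natRk (M.spreadPoint C) = 1 :=
  (h𝒞.flatFamily.natRk_eq (Or.inr ⟨C, hC, rfl⟩)).trans spreadRk_spreadPoint

lemma exists_eq_spreadExt (hX : h𝒞.extension.IsFlat X) (h2 : 2 ≤ h𝒞.extension.natRk X) :
    ∃ F, M.IsFlat F ∧ X = spreadExt 𝒞 F ∧ M.natRk F = h𝒞.extension.natRk X := by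
  obtain ⟨F, hF, rfl⟩ | ⟨C, hC, rfl⟩ := h𝒞.isFlat_extension_iff.1 hX
  · exact ⟨F, hF, rfl, (h𝒞.natRk_spreadExt hF).symm⟩
  · rw [h𝒞.natRk_spreadPoint hC] at h2
    omega

lemma isLine_extension_iff :
    h𝒞.extension.IsLine X ↔ ∃ L, M.IsLine L ∧ X = spreadExt 𝒞 L := by
  constructor
  · intro hX
    rw [isLine_iff] at hX
    obtain ⟨F, hF, h, hr⟩ := h𝒞.exists_eq_spreadExt hX.1 (by omega)
    exact ⟨F, isLine_iff.2 ⟨hF, by omega⟩, h⟩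
  · rintro ⟨L, hL, rfl⟩
    rw [isLine_iff] at hL ⊢
    exact ⟨h𝒞.isFlat_spreadExt hL.1, by rw [h𝒞.natRk_spreadExt hL.1, hL.2]⟩

lemma isPlane_extension_iff :
    h𝒞.extension.IsPlane X ↔ ∃ P, M.IsPlane P ∧ X = spreadExt 𝒞 P := by
  constructor
  · intro hX
    rw [isPlane_iff] at hX
    obtain ⟨F, hF, h, hr⟩ := h𝒞.exists_eq_spreadExt hX.1 (by omega)
    exact ⟨F, isPlane_iff.2 ⟨hF, by omega⟩, h⟩
  · rintro ⟨P, hP, rfl⟩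
    rw [isPlane_iff] at hP ⊢
    exact ⟨h𝒞.isFlat_spreadExt hP.1, by rw [h𝒞.natRk_spreadExt hP.1, hP.2]⟩

instance : h𝒞.extension.HypermodularRankFour := by
  refine ⟨inferInstance, ?_, fun X Y hX hY ↦ ?_⟩
  · rw [extension_E, h𝒞.natRk_spreadExt M.ground_isFlat, HypermodularRankFour.natRk_ground]
  · obtain ⟨P, hP, rfl⟩ := h𝒞.isPlane_extension_iff.1 hX
    obtain ⟨Q, hQ, rfl⟩ := h𝒞.isPlane_extension_iff.1 hY
    have h1 := HypermodularRankFour.two_le_natRk_inter P Q hP hQ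
    rw [← h𝒞.natRk_spreadExt (hP.1.inter hQ.1)] at h1
    exact h1.trans (h𝒞.extension.natRk_mono
      (subset_inter (spreadExt_mono inter_subset_left) (spreadExt_mono inter_subset_right)))

lemma eRank_extension : h𝒞.extension.eRank = 4 := by
  rw [← eRk_ground]
  exact eRk_eq_coe_iff.2 HypermodularRankFour.natRk_ground

/-- `spreadExt 𝒞 F` has the old elements and the rank of `F`, so the flats impose the same bounds as
in `M`; the flat of `M.closure I` alone gives the forward direction. -/
lemma extension_indep_iff : h𝒞.extension.Indep (Sum.inl '' I) ↔ M.Indep I := by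
  have henc : ∀ F : Set α, (Sum.inl '' I ∩ spreadExt 𝒞 F).encard = (I ∩ F).encard := fun F ↦ by
    rw [← image_inter_preimage, preimage_spreadExt, Sum.inl_injective.encard_image]
  constructor
  · intro h
    have hIE : I ⊆ M.E := by
      have := h.subset_ground
      rwa [extension_E, image_subset_iff, preimage_spreadExt] at this
    have hI : h𝒞.flatFamily.Indep (Sum.inl '' I) := h
    have hle := hI.2 _ (Or.inl ⟨_, M.isFlat_closure I, rfl⟩)
    rw [henc, inter_eq_self_of_subset_left (M.subset_closure I)] at hle
    refine (RankFinite.isRkFinite I).indep_of_encard_le_eRk (hle.trans ?_)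
    rw [← coe_natRk, ← M.natRk_closure_eq I, ← h𝒞.spreadRk_spreadExt (M.closure I)]
    rfl
  · intro hI
    refine h𝒞.flatFamily.matroid_indep_iff.2 ⟨?_, ?_⟩
    · exact (image_mono hI.subset_ground).trans subset_union_left
    rintro _ (⟨F, hF, rfl⟩ | ⟨C, hC, rfl⟩)
    · rw [henc]
      refine ((hI.inter_right F).encard_le_eRk_of_subset inter_subset_right).trans ?_
      rw [← coe_natRk, ← h𝒞.spreadRk_spreadExt F]
      rfl
    · rw [← image_inter_preimage, preimage_spreadPoint, Sum.inl_injective.encard_image]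
      refine ((hI.inter_right _).encard_le_eRk_of_subset inter_subset_right).trans ?_
      simp

lemma restrict_extension :
    h𝒞.extension.restrict (Sum.inl '' M.E) = M.mapEmbedding Function.Embedding.inl := by
  refine ext_indep rfl fun I hI ↦ ?_
  obtain ⟨J, hJ, rfl⟩ := subset_image_iff.1 hI
  have hr : Sum.inl '' J ⊆ range (Function.Embedding.inl : α ↪ α ⊕ Set (Set α)) :=
    image_subset_range _ _
  rw [restrict_indep_iff, h𝒞.extension_indep_iff, mapEmbedding_indep_iff,
    and_iff_left (image_mono hJ), and_iff_left hr]
  exact iff_of_eq (congrArg _ (preimage_image_eq J Sum.inl_injective).symm)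

lemma isNonloop_inl : h𝒞.extension.IsNonloop (Sum.inl q) ↔ M.IsNonloop q := by
  rw [← indep_singleton, ← indep_singleton, ← h𝒞.extension_indep_iff, image_singleton]

lemma loops_extension_subset : h𝒞.extension.loops ⊆ spreadExt 𝒞 M.loops :=
  (h𝒞.isFlat_spreadExt (isFlat_loops M)).loops_subset

lemma isNonloop_inr (hC : C ∈ 𝒞) : h𝒞.extension.IsNonloop (Sum.inr C) := by
  have hCs := h𝒞.isSpread C hC
  obtain ⟨L, hL, hLE⟩ := hCs.exists_subset_ground
  rw [isNonloop_iff_notMem_loops (inr_mem_spreadExt.2 ⟨hC, L, hL, hLE⟩)]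
  intro h
  obtain ⟨-, K, hK, hKl⟩ := inr_mem_spreadExt.1 (h𝒞.loops_extension_subset h)
  have := hCs.two_le_natRk hK hKl
  rw [natRk_loops] at this
  omega

/-- The lines of a spread of the extension, restricted to `M`, form a spread. -/
lemma isSpread_preimage {T : Set (Set (α ⊕ Set (Set α)))} (hT : h𝒞.extension.IsSpread T) :
    M.IsSpread {L | M.IsLine L ∧ spreadExt 𝒞 L ∈ T} := by
  refine ⟨fun L hL ↦ hL.1, fun q hq ↦ ?_, fun L hL K hK q hq hqL hqK ↦ ?_, fun L hL K hK ↦ ?_⟩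
  · obtain ⟨X, hX, hqX⟩ := hT.exists_mem _ (h𝒞.isNonloop_inl.2 hq)
    obtain ⟨L, hL, rfl⟩ := h𝒞.isLine_extension_iff.1 (hT.isLine X hX)
    exact ⟨L, ⟨hL, hX⟩, inl_mem_spreadExt.1 hqX⟩
  · have := hT.eq_of_mem _ hL.2 _ hK.2 _ (h𝒞.isNonloop_inl.2 hq) (inl_mem_spreadExt.2 hqL)
      (inl_mem_spreadExt.2 hqK)
    rw [← preimage_spreadExt (𝒞 := 𝒞) (F := L), this, preimage_spreadExt]
  · have h3 := hT.natRk_union_le _ hL.2 _ hK.2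
    have hE : spreadExt 𝒞 L ∪ spreadExt 𝒞 K ⊆ h𝒞.extension.E :=
      union_subset (hT.isLine _ hL.2).1.subset_ground (hT.isLine _ hK.2).1.subset_ground
    have hs := h𝒞.extension.subset_closure _ hE
    have h2 := (isLine_iff.1 (hT.isLine _ hL.2)).2
    have h2' := h𝒞.extension.natRk_mono (subset_union_left.trans hs)
    -- The closure has rank at least 2, so it comes from a flat of `M` of the same rank, which
    -- contains both lines.
    obtain ⟨F, hF, hFe, hr⟩ := h𝒞.exists_eq_spreadExt (isFlat_closure _) (h2.ge.trans h2')
    rw [natRk_closure_eq] at hr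
    rw [hFe] at hs
    have hLK : L ∪ K ⊆ F := by
      have := preimage_mono (f := Sum.inl) hs
      rwa [preimage_union, preimage_spreadExt, preimage_spreadExt, preimage_spreadExt] at this
    have := M.natRk_mono hLK
    omega

/-- Let `T` be a spread of the extension and `S` its restriction. Each `C ∈ 𝒞` is a point, so it
lies on a line of `T`, whose old part is common to `C` and `S`. Maximality puts `S` into `𝒞`, and
the point `S` then lies on every line of `T`. -/
lemma isOTE_extension (hmax : ∀ 𝒟, M.IsCompatible 𝒟 → 𝒞 ⊆ 𝒟 → 𝒟 ⊆ 𝒞) :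
    h𝒞.extension.IsOTE := by
  refine isOTE_of_forall_not_isSpread fun T hT ↦ ?_
  have hS := h𝒞.isSpread_preimage hT
  set S := {L | M.IsLine L ∧ spreadExt 𝒞 L ∈ T} with hSdef
  have hcommon : ∀ C ∈ 𝒞, ∃ L ∈ C, L ∈ S := by
    intro C hC
    obtain ⟨X, hX, hCX⟩ := hT.exists_mem _ (h𝒞.isNonloop_inr hC)
    obtain ⟨L, hL, rfl⟩ := h𝒞.isLine_extension_iff.1 (hT.isLine X hX)
    obtain ⟨-, K, hK, hKL⟩ := inr_mem_spreadExt.1 hCX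
    obtain rfl := ((h𝒞.isSpread C hC).isLine K hK).eq_of_subset hL hKL
    exact ⟨K, hK, hL, hX⟩
  have hself : ∃ L ∈ S, L ∈ S := by
    obtain ⟨L, hL, -⟩ := hS.exists_subset_ground
    exact ⟨L, hL, hL⟩
  have hins : M.IsCompatible (insert S 𝒞) := by
    refine ⟨?_, ?_⟩
    · rintro C (rfl | hC)
      · exact hS
      · exact h𝒞.isSpread C hC
    · rintro C (rfl | hC) D (rfl | hD)
      · exact hself
      · obtain ⟨L, hL, hL'⟩ := hcommon D hD
        exact ⟨L, hL', hL⟩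
      · exact hcommon C hC
      · exact h𝒞.exists_common C hC D hD
  have hSC : S ∈ 𝒞 := hmax _ hins (subset_insert S 𝒞) (mem_insert S 𝒞)
  obtain ⟨L, hL, -⟩ := hS.exists_subset_ground
  have hL2 := isLine_iff.1 hL.1
  obtain ⟨q, hq, hqL⟩ := exists_notMem_of_natRk_le (M := M) (X := L) (by omega)
  rw [hL2.1.closure] at hqL
  obtain ⟨K, hK, hqK⟩ := hS.exists_mem q hq
  have := hT.eq_of_mem _ hL.2 _ hK.2 _ (h𝒞.isNonloop_inr hSC)
    (inr_mem_spreadExt.2 ⟨hSC, L, hL, Subset.rfl⟩) (inr_mem_spreadExt.2 ⟨hSC, K, hK, Subset.rfl⟩)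
  rw [← preimage_spreadExt (𝒞 := 𝒞) (F := L), this, preimage_spreadExt] at hqL
  exact hqL hqK

lemma coplanar_extension_iff (hX : X = spreadExt 𝒞 L) (hY : Y = spreadExt 𝒞 K) :
    h𝒞.extension.Coplanar (X ∪ Y) ↔ M.Coplanar (L ∪ K) := by
  subst hX hY
  constructor
  · rintro ⟨Z, hZ, hsub⟩
    obtain ⟨P, hP, rfl⟩ := h𝒞.isPlane_extension_iff.1 hZ
    refine ⟨P, hP, ?_⟩
    have := preimage_mono (f := Sum.inl) hsub
    rwa [preimage_union, preimage_spreadExt, preimage_spreadExt, preimage_spreadExt] at this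
  · rintro ⟨P, hP, hsub⟩
    exact ⟨_, h𝒞.isPlane_extension_iff.2 ⟨P, hP, rfl⟩, union_subset
      (spreadExt_mono (subset_union_left.trans hsub))
      (spreadExt_mono (subset_union_right.trans hsub))⟩

lemma bundleCondition_extension (hM : M.BundleCondition) : h𝒞.extension.BundleCondition := by
  intro l hl hdisj hcop hfive k m hkm
  choose L hL hlL using fun i ↦ h𝒞.isLine_extension_iff.1 (hl i)
  rw [h𝒞.coplanar_extension_iff (hlL k) (hlL m)]
  refine hM L hL ?_ ?_ ?_ k m hkm
  · intro i j hij x hx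
    have h := hdisj i j hij (show Sum.inl x ∈ l i ∩ l j by
      rw [hlL i, hlL j]
      exact ⟨inl_mem_spreadExt.2 hx.1, inl_mem_spreadExt.2 hx.2⟩)
    exact inl_mem_spreadExt.1 (h𝒞.loops_extension_subset h)
  · rintro i j k hij hjk ⟨P, hP, hsub⟩
    refine hcop i j k hij hjk ⟨_, h𝒞.isPlane_extension_iff.2 ⟨P, hP, rfl⟩, ?_⟩
    rw [hlL i, hlL j, hlL k]
    rw [union_subset_iff, union_subset_iff] at hsub
    exact union_subset (union_subset (spreadExt_mono hsub.1.1) (spreadExt_mono hsub.1.2))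
      (spreadExt_mono hsub.2)
  · obtain ⟨i, j, hij, h⟩ := hfive
    exact ⟨i, j, hij, fun k m hkm hne ↦
      (h𝒞.coplanar_extension_iff (hlL k) (hlL m)).1 (h k m hkm hne)⟩

lemma finite_extension_iff : h𝒞.extension.Finite ↔ M.Finite := by
  constructor
  · intro h
    have hfin := h.ground_finite
    rw [extension_E] at hfin
    exact ⟨(hfin.subset subset_union_left).of_finite_image Sum.inl_injective.injOn⟩
  · intro h
    refine ⟨?_⟩
    rw [extension_E]
    refine (h.ground_finite.image _).union (Finite.image _ ?_)
    refine h.ground_finite.finite_subsets.finite_subsets.subset fun C hC L hL ↦ ?_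
    exact ((h𝒞.isSpread C hC.1).isLine L hL).1.subset_ground

/-- In the contraction of a point of `M`, each new element is parallel to an old one. -/
lemma exists_closure_eq {p : α} (hp : M.IsNonloop p) {b : α ⊕ Set (Set α)}
    (hb : (h𝒞.extension.contract {Sum.inl p}).IsNonloop b) :
    ∃ a, (h𝒞.extension.contract {Sum.inl p}).closure {Sum.inl a} =
      (h𝒞.extension.contract {Sum.inl p}).closure {b} ∧
      (h𝒞.extension.contract {Sum.inl p}).IsNonloop (Sum.inl a) := by
  obtain a | C := b
  · exact ⟨a, rfl, hb⟩
  rw [contract_isNonloop_iff] at hb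
  have hC := (inr_mem_spreadExt.1 hb.1).1
  -- The extended line of `C` through `p` contains `C` and a further old point `a`; contracting `p`
  -- makes `a` and `C` parallel.
  obtain ⟨L, hL, hpL⟩ := (h𝒞.isSpread C hC).exists_mem p hp
  have hLl := (h𝒞.isSpread C hC).isLine L hL
  have hp' := h𝒞.isNonloop_inl.2 hp
  have hr : h𝒞.extension.natRk {Sum.inr C, Sum.inl p} = 2 := by
    rw [natRk_insert_eq hb.1 hb.2, natRk_singleton hp']
  have hflat := h𝒞.isFlat_spreadExt hLl.1
  have hLr : h𝒞.extension.natRk (spreadExt 𝒞 L) = 2 := by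
    rw [h𝒞.natRk_spreadExt hLl.1, (isLine_iff.1 hLl).2]
  have hpair : {Sum.inr C, Sum.inl p} ⊆ spreadExt 𝒞 L := insert_subset
    (inr_mem_spreadExt.2 ⟨hC, L, hL, Subset.rfl⟩)
    (singleton_subset_iff.2 (inl_mem_spreadExt.2 hpL))
  obtain ⟨a, haL, ha⟩ : ∃ a ∈ L, a ∉ M.closure {p} := by
    by_contra! hcon
    have := M.natRk_mono (show L ⊆ M.closure {p} from hcon)
    rw [natRk_closure_eq, natRk_singleton hp, (isLine_iff.1 hLl).2] at this
    omega
  have ha' : (h𝒞.extension.contract {Sum.inl p}).IsNonloop (Sum.inl a) := by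
    rw [contract_isNonloop_iff]
    have haE : Sum.inl a ∈ h𝒞.extension.E :=
      inl_mem_spreadExt.2 (hLl.1.subset_ground haL)
    refine ⟨haE, fun h ↦ ha ?_⟩
    have hcl := (h𝒞.isFlat_spreadExt (M.isFlat_closure {p})).closure_subset
      (singleton_subset_iff.2 (inl_mem_spreadExt.2 (M.mem_closure_self p hp.mem_ground)))
    exact inl_mem_spreadExt.1 (hcl h)
  refine ⟨a, ha'.closure_eq_of_mem_closure ?_, ha'⟩
  rw [contract_closure_eq, singleton_union]
  refine ⟨(isFlat_closure _).subset_of_natRk_le (h𝒞.extension.subset_closure _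
    (hpair.trans hflat.subset_ground)) hpair hflat.subset_ground (by omega)
    (inl_mem_spreadExt.2 haL), fun h ↦ ha'.mem_ground.2 h⟩

lemma contract_extension_indep_iff {p : α} (hp : M.IsNonloop p) :
    (M.contract {p}).Indep I ↔
      (h𝒞.extension.contract {Sum.inl p}).Indep (Sum.inl '' I) := by
  rw [hp.contractElem_indep_iff, (h𝒞.isNonloop_inl.2 hp).contractElem_indep_iff,
    ← image_insert_eq, h𝒞.extension_indep_iff, Sum.inl_injective.mem_set_image]

end IsCompatible

/-! ### Isomorphism of simplifications. -/

section Simplification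

variable {α : Type u} {β : Type v} {A : Matroid α} {B : Matroid β}

lemma Point.isNonloop_rep (P : A.Point) : A.IsNonloop P.rep := P.2.choose_spec.1

lemma Point.closure_rep (P : A.Point) : A.closure {P.rep} = P.1 := P.2.choose_spec.2

lemma Point.rep_injective : Function.Injective (Point.rep (M := A)) := fun P Q h ↦
  Subtype.ext (by rw [← P.closure_rep, h, Q.closure_rep])

/-- Corresponding subfamilies of `g` and `h` have equal closures, so a dependence of one `h i` on
the others carries over to `g i`. -/
lemma Indep.image_of_closure_eq {ι : Type*} {g h : ι → β} (hgh : ∀ i, B.closure {g i} =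
    B.closure {h i}) (hh : ∀ i, h i ∈ B.E) {S : Set ι} (hg : S.InjOn g) (hI : B.Indep (g '' S)) :
    B.Indep (h '' S) := by
  have hcl : ∀ T : Set ι, B.closure (g '' T) = B.closure (h '' T) := by
    intro T
    rw [← biUnion_of_singleton (g '' T), ← biUnion_of_singleton (h '' T), biUnion_image,
      biUnion_image]
    exact B.closure_biUnion_congr _ _ _ fun i _ ↦ hgh i
  rw [indep_iff_forall_notMem_closure_sdiff (by rintro _ ⟨i, -, rfl⟩; exact hh i)]
  rintro _ ⟨i, hi, rfl⟩ hmem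
  refine hI.notMem_closure_sdiff_of_mem (mem_image_of_mem g hi) ?_
  have hsub : h '' S \ {h i} ⊆ h '' (S \ {i}) := by
    rintro _ ⟨⟨j, hj, rfl⟩, hne⟩
    exact ⟨j, ⟨hj, fun h ↦ hne (by rw [h]; rfl)⟩, rfl⟩
  have h1 := B.closure_subset_closure hsub hmem
  rw [← hcl] at h1
  have hsub' : g '' (S \ {i}) ⊆ g '' S \ {g i} := by
    rintro _ ⟨j, hj, rfl⟩
    exact ⟨mem_image_of_mem g hj.1, fun h ↦ hj.2 (hg hj.1 hi h)⟩
  replace h1 := B.closure_subset_closure hsub' h1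
  have h2 : g i ∈ B.closure {h i} := by
    rw [← hgh i]
    exact B.mem_closure_self _ (hI.subset_ground (mem_image_of_mem g hi))
  exact closure_subset_closure_of_subset_closure (singleton_subset_iff.2 h1) h2

/-- If `f` embeds `A` into `B` such that each nonloop of `B` is parallel to an element of the
image of `A`, then the simplifications of `A` and `B` are isomorphic. -/
lemma simplification_isomorphic (f : α → β) (hf : Function.Injective f)
    (hind : ∀ I, A.Indep I ↔ B.Indep (f '' I))
    (hpar : ∀ b, B.IsNonloop b → ∃ a, B.closure {f a} = B.closure {b} ∧ B.IsNonloop (f a)) :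
    B.simplification.Isomorphic A.simplification := by
  have hnl : ∀ {a}, A.IsNonloop a ↔ B.IsNonloop (f a) := by
    intro a
    rw [← indep_singleton, ← indep_singleton, hind, image_singleton]
  have hcl : ∀ {a b}, A.IsNonloop a → A.IsNonloop b →
      (A.closure {a} = A.closure {b} ↔ B.closure {f a} = B.closure {f b}) := by
    intro a b ha hb
    by_cases hab : a = b
    · simp [hab]
    rw [ha.closure_eq_closure_iff_eq_or_dep hb,
      (hnl.1 ha).closure_eq_closure_iff_eq_or_dep (hnl.1 hb), hind, image_pair, hf.eq_iff]
  let φ : A.Point → B.Point := fun P ↦ ⟨B.closure {f P.rep}, f P.rep, hnl.1 P.isNonloop_rep, rfl⟩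
  have hφ : Function.Bijective φ := by
    refine ⟨fun P Q h ↦ ?_, fun Q ↦ ?_⟩
    · have h' : B.closure {f P.rep} = B.closure {f Q.rep} := congrArg Subtype.val h
      rw [← hcl P.isNonloop_rep Q.isNonloop_rep, P.closure_rep, Q.closure_rep] at h'
      exact Subtype.ext h'
    · obtain ⟨a, ha, han⟩ := hpar _ Q.isNonloop_rep
      have ha' := hnl.2 han
      refine ⟨⟨A.closure {a}, a, ha', rfl⟩, Subtype.ext ?_⟩
      rw [← Q.closure_rep, ← ha]
      exact (hcl (Point.isNonloop_rep _) ha').1 (Point.closure_rep _)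
  -- The representative of `φ P` need not be `f P.rep`, only parallel to it;
  -- `Indep.image_of_closure_eq` absorbs the difference.
  have hrep : ∀ P, B.closure {f P.rep} = B.closure {(φ P).rep} := fun P ↦
    (φ P).closure_rep.symm
  have hsimp : ∀ S : Set A.Point, A.simplification.Indep S ↔ B.simplification.Indep (φ '' S) := by
    intro S
    rw [simplification, simplification, comap_indep_iff, comap_indep_iff,
      and_iff_left Point.rep_injective.injOn, and_iff_left Point.rep_injective.injOn, hind,
      image_image, image_image]
    exact ⟨Indep.image_of_closure_eq hrep (fun P ↦ (φ P).isNonloop_rep.mem_ground)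
        (hf.comp Point.rep_injective).injOn,
      Indep.image_of_closure_eq (fun P ↦ (hrep P).symm)
        (fun P ↦ (hnl.1 P.isNonloop_rep).mem_ground)
        (Point.rep_injective.comp hφ.injective).injOn⟩
  have hEA : ∀ P, P ∈ A.simplification.E := fun P ↦ P.isNonloop_rep.mem_ground
  have hEB : ∀ P, P ∈ B.simplification.E := fun P ↦ P.isNonloop_rep.mem_ground
  let ψ := Equiv.ofBijective φ hφ
  let e : A.simplification.E ≃ B.simplification.E :=
    ⟨fun P ↦ ⟨ψ P.1, hEB _⟩, fun Q ↦ ⟨ψ.symm Q.1, hEA _⟩,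
      fun P ↦ Subtype.ext (ψ.symm_apply_apply _), fun Q ↦ Subtype.ext (ψ.apply_symm_apply _)⟩
  refine ⟨e.symm, fun I ↦ ?_⟩
  rw [hsimp]
  refine iff_of_eq (congrArg _ ?_)
  rw [image_image, image_image]
  exact image_congr fun Q _ ↦ (ψ.apply_symm_apply Q.1).symm

end Simplification

end Matroid

/-! ### The theorem, from a maximal compatible set of spreads. -/

theorem mainTheorem4 {α : Type u} (M : Matroid α) (hE : M.E.Countable)
    (hrank : M.eRank = 4) (hM : M.IsHypermodular) :
    ∃ (β : Type u) (e : α ↪ β) (N : Matroid β),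
      -- `N` is an extension of the copy of `M` under `e`
      e '' M.E ⊆ N.E ∧ N.restrict (e '' M.E) = M.mapEmbedding e ∧
      N.eRank = 4 ∧ N.IsOTE ∧
      (∀ L, N.IsLine L → M.IsLine (M.E ∩ e ⁻¹' L)) ∧
      (N.Finite ↔ M.Finite) ∧
      (∀ p, M.IsNonloop p →
        (N.contract {e p}).simplification.Isomorphic (M.contract {p}).simplification) ∧
      (M.BundleCondition → N.IsModular) := by
  have := Matroid.hypermodularRankFour_of_isHypermodular hrank hM
  obtain ⟨𝒞, h𝒞, hmax⟩ := Matroid.exists_maximal_isCompatible M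
  have hOTE := h𝒞.isOTE_extension fun 𝒟 h𝒟 h ↦ hmax h𝒟 h
  refine ⟨α ⊕ Set (Set α), Function.Embedding.inl, h𝒞.extension, Set.subset_union_left,
    h𝒞.restrict_extension, h𝒞.eRank_extension, hOTE, fun X hX ↦ ?_, h𝒞.finite_extension_iff,
    fun p hp ↦ ?_, fun hb ↦ hOTE.isModular (h𝒞.bundleCondition_extension hb)⟩
  · obtain ⟨L, hL, rfl⟩ := h𝒞.isLine_extension_iff.1 hX
    have : M.E ∩ Sum.inl ⁻¹' Matroid.spreadExt 𝒞 L = L := by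
      rw [Matroid.preimage_spreadExt, Set.inter_eq_self_of_subset_right hL.1.subset_ground]
    exact this.symm ▸ hL
  · exact Matroid.simplification_isomorphic Sum.inl Sum.inl_injective
      (fun I ↦ h𝒞.contract_extension_indep_iff hp) (fun b hb ↦ h𝒞.exists_closure_eq hp hb)
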